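/- **Setting.** Let $n\ge 2$ and $\mathcal A=\{1,\dots,n\}$ (arms). An instance $\mathbf P$ consists of probabilities $P_{\succ}^{(i,j)},P_{\cong}^{(i,j)},P_{\prec}^{(i,j)}\ge 0$ ($i,j\in\mathcal A$) with $P_{\succ}^{(i,j)}+P_{\cong}^{(i,j)}+P_{\prec}^{(i,j)}=1$ and $P_{\succ}^{(j,i)}=P_{\prec}^{(i,j)}$. It has *unique modes* if for all $i<j$ one of the three probabilities is strictly larger than the two others. A (possibly randomised) learning algorithm $\mathsf A$ chooses in each round, depending on the past, either a duel $(i,j)\in\mathcal A\times\mathcal A$, for which it observes $i\succ j$, $i\cong j$ or $i\prec j$ with the above probabilities independently of the past, or it stops and returns an arm $\hat\imath$. Let $\tau^{\mathsf A}\in\mathbb N\cup\{\infty\}$ be its number of duels. For $j\in\mathcal A$ put $$L(j)=\{i\ne j: P_{\succ}^{(i,j)}>\max(P_{\prec}^{(i,j)},P_{\cong}^{(i,j)})\},\qquad I(j)=\{i\ne j: P_{\cong}^{(i,j)}>\max(P_{\prec}^{(i,j)},P_{\succ}^{(i,j)})\},$$ $$\mathrm{CP}(i)=\sum_{j\ne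 i}\mathbf 1[P_{\succ}^{(i,j)}>\max(P_{\prec}^{(i,j)},P_{\cong}^{(i,j)})]+\tfrac12\sum_{j\ne i}\mathbf 1[P_{\cong}^{(i,j)}>\max(P_{\succ}^{(i,j)},P_{\prec}^{(i,j)})],$$ $\mathcal C(\mathbf P)=\{i:\mathrm{CP}(i)=\max_k\mathrm{CP}(k)\}$ and $d_j=\max_i\mathrm{CP}(i)-\mathrm{CP}(j)$. The algorithm is *correct with confidence $1-\delta$ at $\mathbf P$* if the probability that it stops and returns an arm outside $\mathcal C(\mathbf P)$ is at most $\delta$. With the Kullback-Leibler divergence $\mathrm{KL}$ of categorical distributions let $$D_{j,z}=\max\{\mathrm{KL}((P_{\succ},P_{\cong},P_{\prec}),(P_{\cong},P_{\succ},P_{\prec})),\ \mathrm{KL}((P_{\succ},P_{\cong},P_{\prec}),(P_{\prec},P_{\cong},P_{\succ}))\}\quad\text{(all at }(j,z)).$$ Let $$\Psi(j)=\{(i,l): 0\le i\le |I(j)|,\ 0\le l\le |L(j)|,\ i+2l\ge 2d_j+1\},$$ $$\Psi'(j)=\{(i,l): 0\le i\le |I(j)|-1,\ 0\le l\le |L(j)|,\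 i+2l\ge 2d_j-1\},$$ $$\Psi''(j)=\{(i,l): 0\le i\le |I(j)|,\ 0\le l\le |L(j)|-1,\ i+2l\ge 2d_j-3\},$$ and, with $a=|I(j)|$, $b=|L(j)|$ and the maximum over the empty set being $0$, $$C_j=\max_{(i,l)\in\Psi(j)}\frac{\binom{a}{i}\binom{b}{l}}{\binom{a-1}{i-1}\binom{b}{l}\mathbf 1[i\ge1]+\binom{a}{i}\binom{b-1}{l-1}\mathbf 1[l\ge1]},$$ $$C'_j=\max_{(i,l)\in\Psi'(j)}\frac{\binom{a-1}{i}\binom{b}{l}}{\binom{a-1}{i}\binom{b}{l}+\binom{a-2}{i-1}\binom{b}{l}\mathbf 1[i\ge1]+\binom{a-1}{i}\binom{b-1}{l-1}\mathbf 1[l\ge1]},$$ $$C''_j=\max_{(i,l)\in\Psi''(j)}\frac{\binom{a}{i}\binom{b-1}{l}}{\binom{a}{i}\binom{b-1}{l}+\binom{a-1}{i-1}\binom{b-1}{l}\mathbf 1[i\ge1]+\binom{a}{i}\binom{b-2}{l-1}\mathbf 1[l\ge1]}.$$ **Theorem.** 1. Let $\mathcal M$ be the class of all instances or the class of all instances with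 unique modes, and let $\delta\in(0,1)$. If $\mathsf A$ is correct with confidence $1-\delta$ at every instance in $\mathcal M$, then for every $\mathbf P\in\mathcal M$ with $\min_{i<j}\min\{P_{\succ}^{(i,j)},P_{\cong}^{(i,j)},P_{\prec}^{(i,j)}\}>0$ and $\mathcal C(\mathbf P)=\{i^\ast\}$, $$\mathbb E_{\mathbf P}[\tau^{\mathsf A}]\ \ge\ \ln\frac1{2.4\,\delta}\sum_{j\ne i^\ast}\max\{C_j,\ C'_j\mathbf 1[i^\ast\in I(j)],\ C''_j\mathbf 1[i^\ast\in L(j)]\}\ \min_{z\in L(j)\cup I(j)}\frac1{D_{j,z}},$$ where a summand whose first factor is $0$ is read as $0$ (also if $L(j)\cup I(j)=\emptyset$). 2. Let $\mathbf P$ have unique modes and $\mathcal C(\mathbf P)=\{i^\ast\}$. For every $j\neq i^\ast$ exactly one of the following holds: (i) $i^\ast\notin L(j)\cup I(j)$ and $\Psi(j)\ne\emptyset$; (ii) $i^\ast\in I(j)$ and $\Psi'(j)\neq\emptyset$; (iii) $i^\ast\in L(j)$ and $\Psi''(j)\ne\emptyset$. Moreover $\max\{C_j,C'_j\mathbf 1[i^\ast\in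 I(j)],C''_j\mathbf 1[i^\ast\in L(j)]\}>0$. 3. If, in addition to 2., all probabilities $P_{\succ}^{(i,j)},P_{\cong}^{(i,j)},P_{\prec}^{(i,j)}$ with $i<j$ are positive and $0<\delta<1/2.4$, then the right-hand side of the bound in 1. is positive. -/

import Mathlib

open MeasureTheory ProbabilityTheory
open scoped ENNReal NNReal

noncomputable section

namespace DuelingBandits

/-- The three possible observations of a duel `(i, j)`: `i ≻ j`, `i ≅ j`, `i ≺ j`. -/
inductive Outcome : Type
  | succ : Outcome
  | indiff : Outcome
  | prec : Outcome
  deriving DecidableEq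

instance : Fintype Outcome :=
  ⟨{.succ, .indiff, .prec}, fun o => by cases o <;> simp⟩

/-- A dueling bandits problem with indifferences on the arms `Fin n`:
`prob o i j` is the probability of observing `o` in the duel `(i, j)`. -/
structure Instance (n : ℕ) where
  prob : Outcome → Fin n → Fin n → ℝ
  prob_nonneg : ∀ o i j, 0 ≤ prob o i j
  prob_sum : ∀ i j, prob .succ i j + prob .indiff i j + prob .prec i j = 1
  prob_symm : ∀ i j, prob .succ j i = prob .prec i j

namespace Instance

variable {n : ℕ} (P : Instance n)

/-- `L(j)`: the arms superior to `j`. -/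
def L (j : Fin n) : Finset (Fin n) :=
  open Classical in
  {i | i ≠ j ∧ max (P.prob .prec i j) (P.prob .indiff i j) < P.prob .succ i j}

/-- `I(j)`: the arms indifferent to `j`. -/
def I (j : Fin n) : Finset (Fin n) :=
  open Classical in
  {i | i ≠ j ∧ max (P.prob .prec i j) (P.prob .succ i j) < P.prob .indiff i j}

/-- The Copeland score of arm `i`. -/
def CP (i : Fin n) : ℝ :=
  open Classical in
  (∑ j ∈ Finset.univ.erase i,
      if max (P.prob .prec i j) (P.prob .indiff i j) < P.prob .succ i j then (1 : ℝ) else 0) +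
    1 / 2 * ∑ j ∈ Finset.univ.erase i,
      if max (P.prob .succ i j) (P.prob .prec i j) < P.prob .indiff i j then (1 : ℝ) else 0

/-- The Copeland set, i.e. the set of arms with maximal Copeland score. -/
def copelandSet : Set (Fin n) := {i | ∀ j, P.CP j ≤ P.CP i}

/-- `d_j`: the largest Copeland score minus the Copeland score of `j`. -/
def d (j : Fin n) : ℝ := (⨆ i, P.CP i) - P.CP j

/-- All outcome probabilities of all duels of two different arms are positive. -/
def IsPositive : Prop := ∀ i j, i < j → ∀ o, 0 < P.prob o i j

/-- Every duel of two different arms has a unique most likely outcome. -/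
def HasUniqueModes : Prop :=
  ∀ i j, i < j → ∃ o, ∀ o', o' ≠ o → P.prob o' i j < P.prob o i j

end Instance

/-- Kullback-Leibler divergence of two categorical distributions with probability vectors `p`, `q`
(the sum is nonnegative for probability vectors). -/
def KL {K : Type*} [Fintype K] (p q : K → ℝ) : ℝ≥0∞ :=
  open Classical in
  if ∀ k, q k = 0 → p k = 0 then
    ENNReal.ofReal (∑ k with 0 < p k, p k * Real.log (p k / q k))
  else ⊤

namespace Instance

variable {n : ℕ} (P : Instance n)

/-- `D_{x,y}`: the larger one of the divergences from the outcome distribution of the duel `(x, y)`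
to the two distributions that arise from it when the probabilities of `≻` and `≅`,
respectively of `≻` and `≺`, are exchanged. -/
def D (x y : Fin n) : ℝ≥0∞ :=
  max
    (KL ![P.prob .succ x y, P.prob .indiff x y, P.prob .prec x y]
      ![P.prob .indiff x y, P.prob .succ x y, P.prob .prec x y])
    (KL ![P.prob .succ x y, P.prob .indiff x y, P.prob .prec x y]
      ![P.prob .prec x y, P.prob .indiff x y, P.prob .succ x y])

/-- `Ψ(j)`. -/
def Psi (j : Fin n) : Finset (ℕ × ℕ) :=
  open Classical in
  {x ∈ Finset.range ((P.I j).card + 1) ×ˢ Finset.range ((P.L j).card + 1) |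
    2 * P.d j + 1 ≤ (x.1 : ℝ) + 2 * (x.2 : ℝ)}

/-- `Ψ'(j)`; its first index runs from `0` to `|I(j)| - 1`. -/
def Psi' (j : Fin n) : Finset (ℕ × ℕ) :=
  open Classical in
  {x ∈ Finset.range (P.I j).card ×ˢ Finset.range ((P.L j).card + 1) |
    2 * P.d j - 1 ≤ (x.1 : ℝ) + 2 * (x.2 : ℝ)}

/-- `Ψ''(j)`; its second index runs from `0` to `|L(j)| - 1`. -/
def Psi'' (j : Fin n) : Finset (ℕ × ℕ) :=
  open Classical in
  {x ∈ Finset.range ((P.I j).card + 1) ×ˢ Finset.range (P.L j).card |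
    2 * P.d j - 3 ≤ (x.1 : ℝ) + 2 * (x.2 : ℝ)}

/-- `C_j`, a maximum over `Ψ(j)` (equal to `0` if `Ψ(j)` is empty). -/
def C (j : Fin n) : ℝ≥0 :=
  (P.Psi j).sup fun (i, l) =>
    (((P.I j).card.choose i * (P.L j).card.choose l : ℕ) : ℝ≥0) /
      (((if 1 ≤ i then ((P.I j).card - 1).choose (i - 1) * (P.L j).card.choose l else 0) +
        (if 1 ≤ l then (P.I j).card.choose i * ((P.L j).card - 1).choose (l - 1) else 0) : ℕ) : ℝ≥0)

/-- `C'_j`, a maximum over `Ψ'(j)` (equal to `0` if `Ψ'(j)` is empty). -/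
def C' (j : Fin n) : ℝ≥0 :=
  (P.Psi' j).sup fun (i, l) =>
    ((((P.I j).card - 1).choose i * (P.L j).card.choose l : ℕ) : ℝ≥0) /
      ((((P.I j).card - 1).choose i * (P.L j).card.choose l +
        (if 1 ≤ i then ((P.I j).card - 2).choose (i - 1) * (P.L j).card.choose l else 0) +
        (if 1 ≤ l then ((P.I j).card - 1).choose i * ((P.L j).card - 1).choose (l - 1)
          else 0) : ℕ) : ℝ≥0)

/-- `C''_j`, a maximum over `Ψ''(j)` (equal to `0` if `Ψ''(j)` is empty). -/
def C'' (j : Fin n) : ℝ≥0 :=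
  (P.Psi'' j).sup fun (i, l) =>
    (((P.I j).card.choose i * ((P.L j).card - 1).choose l : ℕ) : ℝ≥0) /
      (((P.I j).card.choose i * ((P.L j).card - 1).choose l +
        (if 1 ≤ i then ((P.I j).card - 1).choose (i - 1) * ((P.L j).card - 1).choose l else 0) +
        (if 1 ≤ l then (P.I j).card.choose i * ((P.L j).card - 2).choose (l - 1)
          else 0) : ℕ) : ℝ≥0)

/-- The factor of arm `j`: the maximum of `C_j`, `C'_j · 1[i* ∈ I(j)]` and `C''_j · 1[i* ∈ L(j)]`. -/
def factor (iStar j : Fin n) : ℝ≥0 :=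
  max (P.C j)
    (max (if iStar ∈ P.I j then P.C' j else 0) (if iStar ∈ P.L j then P.C'' j else 0))

/-- The lower bound `ln (1 / (2.4 δ)) * ∑_{j ≠ i*} factor_j * min_{z ∈ L(j) ∪ I(j)} 1 / D_{j,z}`.
A negative logarithm is truncated to `0`, which does not matter for a lower bound on an expected
number of samples. A minimum over the empty set is `∞`, and `0 * ∞ = 0`. -/
def lowerBound (iStar : Fin n) (δ : ℝ) : ℝ≥0∞ :=
  ENNReal.ofReal (Real.log (1 / (2.4 * δ))) *
    ∑ j ∈ Finset.univ.erase iStar,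
      (P.factor iStar j : ℝ≥0∞) * (P.L j ∪ P.I j).inf fun z => 1 / P.D j z

/-- The distribution of the observation in the duel `(i, j)`. -/
def outcomePMF (i j : Fin n) : PMF Outcome :=
  PMF.ofFintype (fun o => ENNReal.ofReal (P.prob o i j)) (by
    have h : (Finset.univ : Finset Outcome) = {.succ, .indiff, .prec} := rfl
    have h₀ := fun o => P.prob_nonneg o i j
    rw [← ENNReal.ofReal_sum_of_nonneg fun o _ => h₀ o, h, ← ENNReal.ofReal_one,
      ← P.prob_sum i j]
    congr 1
    simp [add_assoc])

end Instance

/-- One round of the learning process: a duel and its observation. -/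
abbrev Round (n : ℕ) : Type := (Fin n × Fin n) × Outcome

/-- A (possibly randomised) learning algorithm: depending on all duels and observations so far (most
recent first), it chooses either the next duel (`Sum.inl`), or it stops and returns an arm
(`Sum.inr`). -/
structure Learner (n : ℕ) where
  policy : List (Round n) → PMF ((Fin n × Fin n) ⊕ Fin n)

/-- A state of the learning process: the rounds so far (most recent first), and the returned arm
if the learner has stopped. -/
structure State (n : ℕ) where
  history : List (Round n)
  output : Option (Fin n)

instance (n : ℕ) : MeasurableSpace (State n) := ⊤

namespace Learner

variable {n : ℕ} (A : Learner n) (P : Instance n)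

/-- One step of the learning process; nothing changes any more after the learner has stopped. -/
def step : State n → PMF (State n)
  | ⟨h, some i⟩ => PMF.pure ⟨h, some i⟩
  | ⟨h, none⟩ => (A.policy h).bind fun a =>
      match a with
      | .inl (i, j) => (P.outcomePMF i j).map fun o => ⟨((i, j), o) :: h, none⟩
      | .inr i => PMF.pure ⟨h, some i⟩

/-- The transition kernel of the learning process. -/
def stepKernel : Kernel (State n) (State n) where
  toFun s := (A.step P s).toMeasure
  measurable' := measurable_from_top

instance : IsMarkovKernel (A.stepKernel P) :=
  ⟨fun s => inferInstanceAs (IsProbabilityMeasure (A.step P s).toMeasure)⟩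

/-- `ℙ_P`: the law of the whole learning process (a Markov chain that starts without any rounds)
when the learner `A` faces the instance `P`. -/
def law : Measure (ℕ → State n) :=
  Kernel.trajMeasure (X := fun _ => State n) (Measure.dirac ⟨[], none⟩) fun t =>
    (A.stepKernel P).comap (fun ω => ω ⟨t, Finset.mem_Iic.2 le_rfl⟩) (measurable_pi_apply _)

/-- `τ`: the number of samples, i.e. of duels made (infinite if the learner never stops). -/
def sampleCount (ω : ℕ → State n) : ℕ∞ := ⨆ t, ((ω t).history.length : ℕ∞)

/-- `𝔼_P[τ]`. -/
def expectedSamples : ℝ≥0∞ := ∫⁻ ω, (sampleCount ω : ℝ≥0∞) ∂(A.law P)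

/-- The learner identifies a Copeland winner of `P` with confidence `1 - δ`: the probability that it
stops with an arm outside of the Copeland set is at most `δ`. -/
def IsCorrectAt (δ : ℝ) : Prop :=
  A.law P {ω | ∃ t, ∃ i, (ω t).output = some i ∧ i ∉ P.copelandSet} ≤ ENNReal.ofReal δ

end Learner

end DuelingBandits

end

open DuelingBandits

noncomputable section

namespace DuelingBandits

/-! ### Numerical inequalities -/

/-! Fix an arm `j ≠ i*`. If `j` is made to win its duels against a set `S` of superior or
indifferent arms, and its score thereby passes that of `i*`, then a learner that is correct at both
instances must tell them apart. The expected log-likelihood ratio is thus at least the binary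
relative entropy of `1 - δ` and `δ`, hence at least `ln (1 / (2.4 δ))` (`log_one_div_le_binaryKL`).
By Wald's identity this ratio is a sum over `z ∈ S` of divergences times expected numbers of duels
of `j` and `z` (`le_sum_visits_mul_mean`, `le_sum_point_mul_pairVisits`).

Averaging over all `S` with prescribed numbers of indifferent and superior arms, with `i*` free or
forced into `S`, produces the binomial quotients `C`, `C'`, `C''` (`choose_div_mul_le`,
`factor_mul_le`). The results are then summed over `j`.

In this sum a duel of two indifferent arms is charged to both of them, and exchanging probabilities
would lose a factor 2. The remedy is a cheaper alternative: if `≅` is the strict mode, some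
distribution with strict mode `≻` has at most half the divergence of the exchange
(`exists_mode_change`). Charges are therefore weighted by Copeland points, which add up to at most 1
per duel (`sum_point_mul_pairVisits_le`).

Everything is done for `t` steps, where expectations are iterates of a one-step operator. The
probability of being unfinished is at most `𝔼[τ] / t` and disappears as `t → ∞`.

With unique modes, `j` overtakes `i*` once it wins all duels it did not win before
(`HasUniqueModes.d_le`); this makes the relevant `Ψ`-set nonempty. -/

lemma two_mul_le_log_div {x : ℝ} (hx : 0 ≤ x) (hx1 : x < 1) :
    2 * x ≤ Real.log (1 + x) - Real.log (1 - x) := by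
  have h := Real.hasSum_log_sub_log_of_abs_lt_one (x := x) (by rw [abs_of_nonneg hx]; exact hx1)
  simpa using sum_le_hasSum (Finset.range 1) (fun k _ => by positivity) h

/-- Termwise comparison of the power series of `y (ln (1 + y) - ln (1 - y))` and `-2 ln (1 - y²)`:
the coefficients satisfy `2 / (2k + 1) ≤ 2 / (k + 1)`. -/
lemma log_sum_le {y : ℝ} (hy : 0 ≤ y) (hy1 : y < 1) :
    (2 + y) * Real.log (1 + y) + (2 - y) * Real.log (1 - y) ≤ 0 := by
  have h1 := Real.hasSum_log_sub_log_of_abs_lt_one (x := y) (by rw [abs_of_nonneg hy]; exact hy1)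
  have h2 := Real.hasSum_pow_div_log_of_abs_lt_one (x := y ^ 2)
    (by rw [abs_of_nonneg (sq_nonneg _)]; nlinarith)
  have h3 : Real.log (1 - y ^ 2) = Real.log (1 + y) + Real.log (1 - y) := by
    rw [← Real.log_mul (by linarith) (by linarith)]; ring_nf
  have h := hasSum_le (fun k : ℕ => ?_) (h1.mul_left y) (h2.mul_left 2)
  · rw [h3] at h; nlinarith
  · have e1 : y * (2 * (1 / (2 * (k : ℝ) + 1)) * y ^ (2 * k + 1)) =
      (y ^ 2) ^ (k + 1) * (2 / (2 * k + 1)) := by rw [← pow_mul]; ring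
    have e2 : 2 * ((y ^ 2) ^ (k + 1) / ((k : ℝ) + 1)) = (y ^ 2) ^ (k + 1) * (2 / (k + 1)) := by ring
    rw [e1, e2]
    gcongr
    have : (0 : ℝ) ≤ k := k.cast_nonneg
    linarith

/-- The binary relative entropy of `1 - δ` and `δ` is at least `ln (1 / (2.4 δ))`. -/
lemma log_one_div_le_binaryKL {δ : ℝ} (h0 : 0 < δ) (h1 : δ < 1) :
    Real.log (1 / (2.4 * δ)) ≤ (1 - 2 * δ) * Real.log ((1 - δ) / δ) := by
  -- The difference of the two sides is `2δ ln δ + (1 - 2δ) ln (1 - δ) + ln 2.4`, with a small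
  -- positive minimum near `δ = 13/40`. Tangent bounds at that point leave a linear function of `δ`,
  -- which `n1` and `n2` make nonnegative.
  have t1 : Real.log (13 / 40 / δ) ≤ 13 / 40 / δ - 1 :=
    Real.log_le_sub_one_of_pos (by positivity)
  have t2 : Real.log (27 / 40 / (1 - δ)) ≤ 27 / 40 / (1 - δ) - 1 :=
    Real.log_le_sub_one_of_pos (by have : 0 < 1 - δ := by linarith
                                   positivity)
  have t3 : Real.log ((1 - δ) / (27 / 40)) ≤ (1 - δ) / (27 / 40) - 1 :=
    Real.log_le_sub_one_of_pos (by have : 0 < 1 - δ := by linarith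
                                   positivity)
  have h1' : 0 < 1 - δ := by linarith
  rw [Real.log_div (by norm_num) h0.ne'] at t1
  rw [Real.log_div (by norm_num) h1'.ne'] at t2
  rw [Real.log_div h1'.ne' (by norm_num)] at t3
  rw [Real.log_div h1'.ne' h0.ne', one_div, Real.log_inv, Real.log_mul (by norm_num) h0.ne']
  have t1' : δ * Real.log (13 / 40) - δ * Real.log δ ≤ 13 / 40 - δ := by
    have := mul_le_mul_of_nonneg_left t1 h0.le
    have e : δ * (13 / 40 / δ - 1) = 13 / 40 - δ := by field_simp
    linarith
  have t2' : (1 - δ) * Real.log (27 / 40) - (1 - δ) * Real.log (1 - δ) ≤ 27 / 40 - (1 - δ) := by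
    have := mul_le_mul_of_nonneg_left t2 h1'.le
    have e : (1 - δ) * (27 / 40 / (1 - δ) - 1) = 27 / 40 - (1 - δ) := by field_simp
    linarith
  have n1 : Real.log (27 / 40) - Real.log (13 / 40) ≤ 20 / 27 := by
    rw [← Real.log_div (by norm_num) (by norm_num), Real.log_le_iff_le_exp (by norm_num)]
    refine le_trans ?_ (Real.sum_le_exp_of_nonneg (by norm_num) 4)
    norm_num [Finset.sum_range_succ, Nat.factorial]
  have n2 : 13 / 27 ≤ Real.log 2.4 + Real.log (27 / 40) := by
    rw [← Real.log_mul (by norm_num) (by norm_num)]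
    have h := Real.hasSum_log_sub_log_of_abs_lt_one (x := 31 / 131) (by norm_num [abs_of_pos])
    have h' := sum_le_hasSum (Finset.range 2) (fun k _ => by positivity) h
    rw [← Real.log_div (by norm_num) (by norm_num)] at h'
    norm_num [Finset.sum_range_succ] at h' ⊢
    linarith
  have := mul_le_mul_of_nonneg_left n1 h0.le
  linarith

/-- Convexity of the divergence in its second argument, one coordinate at a time. -/
lemma mul_log_div_mix_le {p a b t : ℝ} (hp : 0 < p) (ha : 0 < a) (hb : 0 < b) (ht : 0 ≤ t)
    (ht1 : t ≤ 1) :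
    p * Real.log (p / ((1 - t) * a + t * b)) ≤
      (1 - t) * (p * Real.log (p / a)) + t * (p * Real.log (p / b)) := by
  have h := strictConcaveOn_log_Ioi.concaveOn.2 (Set.mem_Ioi.2 ha) (Set.mem_Ioi.2 hb)
    (sub_nonneg.2 ht1) ht (by ring)
  simp only [smul_eq_mul] at h
  have hm : 0 < (1 - t) * a + t * b := by
    rcases ht.eq_or_lt with rfl | ht
    · simpa using ha
    · have := mul_nonneg (sub_nonneg.2 ht1) ha.le
      positivity
  rw [Real.log_div hp.ne' hm.ne', Real.log_div hp.ne' ha.ne', Real.log_div hp.ne' hb.ne']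
  nlinarith [mul_le_mul_of_nonneg_left h hp.le]

lemma exists_weak_mode_change {s e r : ℝ} (hs : 0 < s) (he : 0 < e) (hr : 0 < r)
    (hsum : s + e + r = 1) (hse : s < e) (hre : r < e) :
    ∃ s' e' r' : ℝ, 0 < s' ∧ 0 < e' ∧ 0 < r' ∧ s' + e' + r' = 1 ∧ e' ≤ s' ∧ r' ≤ s' ∧
      s * Real.log (s / s') + e * Real.log (e / e') + r * Real.log (r / r') ≤
        5 / 12 * ((e - s) * Real.log (e / s)) := by
  -- Levelling `s` and `e` to their mean `m` costs at most a quarter of the exchange. It suffices if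
  -- `r ≤ m`; otherwise the uniform distribution is used.
  obtain ⟨m, hm⟩ : ∃ m, m = (e + s) / 2 := ⟨_, rfl⟩
  have hm0 : 0 < m := by rw [hm]; positivity
  obtain ⟨y, hy⟩ : ∃ y, y = (e - s) / (2 * m) := ⟨_, rfl⟩
  have hy0 : 0 ≤ y := by rw [hy]; exact div_nonneg (by linarith) (by linarith)
  have hy1 : y < 1 := by rw [hy, div_lt_one (by positivity)]; linarith
  have hmy : m * y = (e - s) / 2 := by rw [hy]; field_simp
  have hem : e = m * (1 + y) := by linarith
  have hsm : s = m * (1 - y) := by linarith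
  have e1 : e / m = 1 + y := by rw [hem]; field_simp
  have s1 : s / m = 1 - y := by rw [hsm]; field_simp
  have hlog : Real.log (e / s) = Real.log (1 + y) - Real.log (1 - y) := by
    rw [← Real.log_div (by linarith) (by linarith), ← e1, ← s1]
    congr 1
    field_simp
  have hA : s * Real.log (s / m) + e * Real.log (e / m) ≤
      1 / 4 * ((e - s) * Real.log (e / s)) := by
    have h := mul_le_mul_of_nonneg_left (log_sum_le hy0 hy1) hm0.le
    rw [hlog, e1, s1, hsm, hem]
    linarith
  have hΔ : 4 * m * y ^ 2 ≤ (e - s) * Real.log (e / s) := by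
    rw [hlog]
    have h := mul_le_mul_of_nonneg_left (two_mul_le_log_div hy0 hy1) (mul_nonneg hm0.le hy0)
    have : e - s = 2 * (m * y) := by linarith
    rw [this]
    linarith
  have hΔ0 : 0 ≤ (e - s) * Real.log (e / s) := le_trans (by positivity) hΔ
  rcases le_total r m with hrm | hrm
  · refine ⟨m, m, r, hm0, hm0, hr, by linarith, le_rfl, hrm, ?_⟩
    rw [div_self hr.ne', Real.log_one]
    linarith
  · refine ⟨1 / 3, 1 / 3, 1 / 3, by norm_num, by norm_num, by norm_num, by norm_num, le_rfl,
      le_rfl, ?_⟩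
    have h1 : Real.log (s / (1 / 3)) = Real.log (s / m) + Real.log (3 * m) := by
      rw [← Real.log_mul (by positivity) (by positivity)]; congr 1; field_simp
    have h2 : Real.log (e / (1 / 3)) = Real.log (e / m) + Real.log (3 * m) := by
      rw [← Real.log_mul (by positivity) (by positivity)]; congr 1; field_simp
    have h3 : Real.log (3 * m) ≤ 3 * m - 1 := Real.log_le_sub_one_of_pos (by positivity)
    have h4 : Real.log (r / (1 / 3)) ≤ 3 * r - 1 := by
      refine (Real.log_le_sub_one_of_pos (by positivity)).trans_eq ?_
      ring
    have h5 := mul_le_mul_of_nonneg_left h3 (add_pos he hs).le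
    have h6 := mul_le_mul_of_nonneg_left h4 hr.le
    -- The extra cost of the uniform distribution is at most `2 (1 - 3m)²`. As `r < e` gives `1 - 3m
    -- ≤ m y`, this is at most a sixth of the exchange, and `1/4 + 1/6 = 5/12`.
    have h7 : (e + s) * (3 * m - 1) + r * (3 * r - 1) = 2 * (1 - 3 * m) ^ 2 := by
      have : r = 1 - 2 * m := by linarith
      rw [this, show e + s = 2 * m by linarith]
      ring
    have h8 : 1 - 3 * m ≤ m * y := by linarith
    have h9 : (1 - 3 * m) ^ 2 ≤ (m * y) ^ 2 := pow_le_pow_left₀ (by linarith) h8 2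
    have h10 : 3 * m ≤ 1 := by linarith
    have h11 : (m * y) ^ 2 ≤ 1 / 3 * (m * y ^ 2) := by
      have : (m * y) ^ 2 = m * (m * y ^ 2) := by ring
      rw [this]
      exact mul_le_mul_of_nonneg_right (by linarith) (by positivity)
    rw [h1, h2]
    linarith

/-- If `e` is the strict mode of `(s, e, r)`, then some distribution whose strict mode is the first
entry has at most half the divergence that exchanging `s` and `e` has. -/
lemma exists_mode_change {s e r : ℝ} (hs : 0 < s) (he : 0 < e) (hr : 0 < r)
    (hsum : s + e + r = 1) (hse : s < e) (hre : r < e) :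
    ∃ s' e' r' : ℝ, 0 < s' ∧ 0 < e' ∧ 0 < r' ∧ s' + e' + r' = 1 ∧ e' < s' ∧ r' < s' ∧
      s * Real.log (s / s') + e * Real.log (e / e') + r * Real.log (r / r') ≤
        1 / 2 * ((e - s) * Real.log (e / s)) := by
  obtain ⟨s', e', r', hs', he', hr', hsum', h1, h2, h⟩ :=
    exists_weak_mode_change hs he hr hsum hse hre
  -- Mixing in a little of the exchanged distribution `(e, s, r)` makes the mode strict. Any weight
  -- `w` in `(0, 1/7]` works, since `(1 - w) 5/12 + w ≤ 1/2`.
  refine ⟨(1 - 1 / 20) * s' + 1 / 20 * e, (1 - 1 / 20) * e' + 1 / 20 * s,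
    (1 - 1 / 20) * r' + 1 / 20 * r, by linarith, by linarith, by linarith, by linarith,
    by linarith, by linarith, ?_⟩
  have k1 := mul_log_div_mix_le (t := 1 / 20) hs hs' he (by norm_num) (by norm_num)
  have k2 := mul_log_div_mix_le (t := 1 / 20) he he' hs (by norm_num) (by norm_num)
  have k3 := mul_log_div_mix_le (t := 1 / 20) hr hr' hr (by norm_num) (by norm_num)
  have hl : Real.log (s / e) = - Real.log (e / s) := by rw [← Real.log_inv, inv_div]
  have hp : 0 ≤ (e - s) * Real.log (e / s) :=
    mul_nonneg (by linarith) (Real.log_nonneg ((one_le_div hs).2 hse.le))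
  rw [div_self hr.ne', Real.log_one] at k3
  rw [hl] at k1
  linarith

/-! ### The marginals of the learning process -/

section PMFSums

variable {α β : Type*}

lemma tsum_pure_mul (a : α) (f : α → ℝ≥0∞) : ∑' x, PMF.pure a x * f x = f a := by
  rw [tsum_eq_single a (fun b hb => by simp [hb])]
  simp

lemma tsum_bind_mul (p : PMF α) (q : α → PMF β) (f : β → ℝ≥0∞) :
    ∑' x, p.bind q x * f x = ∑' a, p a * ∑' x, q a x * f x := by
  simp_rw [PMF.bind_apply, ← ENNReal.tsum_mul_right, ← ENNReal.tsum_mul_left]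
  rw [ENNReal.tsum_comm]
  simp_rw [mul_assoc]

lemma tsum_map_mul (p : PMF α) (g : α → β) (f : β → ℝ≥0∞) :
    ∑' x, p.map g x * f x = ∑' a, p a * f (g a) := by
  rw [PMF.map, tsum_bind_mul]
  exact tsum_congr fun a => by rw [Function.comp_apply, tsum_pure_mul]

lemma lintegral_toMeasure [Countable α] [MeasurableSpace α] [MeasurableSingletonClass α]
    (p : PMF α) (f : α → ℝ≥0∞) : ∫⁻ x, f x ∂p.toMeasure = ∑' x, p x * f x := by
  rw [lintegral_countable']
  exact tsum_congr fun a => by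
    rw [PMF.toMeasure_apply_singleton _ _ (measurableSet_singleton a), mul_comm]

end PMFSums

instance : Countable Outcome := Finite.to_countable

instance (n : ℕ) : Countable (State n) :=
  Function.Injective.countable (f := fun s : State n => (s.history, s.output))
    (by rintro ⟨h, o⟩ ⟨h', o'⟩ e; simpa using e)

instance (n : ℕ) : MeasurableSingletonClass (State n) := ⟨fun _ => trivial⟩

lemma sum_outcome {M : Type*} [AddCommMonoid M] (f : Outcome → M) :
    ∑ o, f o = f .succ + f .indiff + f .prec := by
  have h : (Finset.univ : Finset Outcome) = {.succ, .indiff, .prec} := rfl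
  rw [h]
  simp [add_assoc]

namespace Learner

variable {n : ℕ} (A : Learner n) (P : Instance n)

/-- The conditional expectation of `f` after one more step of the learning process. -/
def next (f : State n → ℝ) : State n → ℝ
  | ⟨h, some i⟩ => f ⟨h, some i⟩
  | ⟨h, none⟩ =>
    ∑ x : Fin n × Fin n,
        (A.policy h (.inl x)).toReal * ∑ o, P.prob o x.1 x.2 * f ⟨(x, o) :: h, none⟩ +
      ∑ i, (A.policy h (.inr i)).toReal * f ⟨h, some i⟩

/-- The expectation of `f` after `t` steps of the learning process. -/
def expect (t : ℕ) (f : State n → ℝ) : ℝ := (A.next P)^[t] f ⟨[], none⟩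

lemma next_none (f : State n → ℝ) (h : List (Round n)) :
    A.next P f ⟨h, none⟩ = ∑ x : Fin n × Fin n,
        (A.policy h (.inl x)).toReal * ∑ o, P.prob o x.1 x.2 * f ⟨(x, o) :: h, none⟩ +
      ∑ i, (A.policy h (.inr i)).toReal * f ⟨h, some i⟩ := rfl

lemma next_some (f : State n → ℝ) (h : List (Round n)) (i : Fin n) :
    A.next P f ⟨h, some i⟩ = f ⟨h, some i⟩ := rfl

lemma next_mono {f g : State n → ℝ} (hfg : f ≤ g) : A.next P f ≤ A.next P g := by
  rintro ⟨h, _ | i⟩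
  · simp only [next_none]
    gcongr
    · exact P.prob_nonneg _ _ _
    · exact hfg _
    · exact hfg _
  · exact hfg _

lemma next_nonneg {f : State n → ℝ} (hf : 0 ≤ f) : 0 ≤ A.next P f := by
  rintro ⟨h, _ | i⟩
  · simp only [next_none]
    exact add_nonneg
      (Finset.sum_nonneg fun x _ => mul_nonneg ENNReal.toReal_nonneg
        (Finset.sum_nonneg fun o _ => mul_nonneg (P.prob_nonneg _ _ _) (hf _)))
      (Finset.sum_nonneg fun x _ => mul_nonneg ENNReal.toReal_nonneg (hf _))
  · exact hf _

lemma lintegral_stepKernel {f : State n → ℝ} (hf : 0 ≤ f) (s : State n) :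
    ∫⁻ x, ENNReal.ofReal (f x) ∂A.stepKernel P s = ENNReal.ofReal (A.next P f s) := by
  change ∫⁻ x, ENNReal.ofReal (f x) ∂(A.step P s).toMeasure = _
  rw [lintegral_toMeasure]
  obtain ⟨h, _ | i⟩ := s
  · have hne : ∀ a, A.policy h a ≠ ⊤ := fun a => PMF.apply_ne_top _ _
    rw [step, tsum_bind_mul, next_none, tsum_fintype, Fintype.sum_sum_type,
      ENNReal.ofReal_add, ENNReal.ofReal_sum_of_nonneg, ENNReal.ofReal_sum_of_nonneg]
    · congr 1
      · refine Finset.sum_congr rfl fun x _ => ?_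
        rw [ENNReal.ofReal_mul ENNReal.toReal_nonneg, ENNReal.ofReal_toReal (hne _),
          ENNReal.ofReal_sum_of_nonneg]
        · simp only
          rw [tsum_map_mul, tsum_fintype]
          congr 1
          refine Finset.sum_congr rfl fun o _ => ?_
          rw [ENNReal.ofReal_mul (P.prob_nonneg _ _ _)]
          rfl
        · exact fun o _ => mul_nonneg (P.prob_nonneg _ _ _) (hf _)
      · refine Finset.sum_congr rfl fun i _ => ?_
        rw [ENNReal.ofReal_mul ENNReal.toReal_nonneg, ENNReal.ofReal_toReal (hne _)]
        simp only
        rw [tsum_pure_mul]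
    · exact fun i _ => mul_nonneg ENNReal.toReal_nonneg (hf _)
    · exact fun x _ => mul_nonneg ENNReal.toReal_nonneg
        (Finset.sum_nonneg fun o _ => mul_nonneg (P.prob_nonneg _ _ _) (hf _))
    · exact Finset.sum_nonneg fun x _ => mul_nonneg ENNReal.toReal_nonneg
        (Finset.sum_nonneg fun o _ => mul_nonneg (P.prob_nonneg _ _ _) (hf _))
    · exact Finset.sum_nonneg fun i _ => mul_nonneg ENNReal.toReal_nonneg (hf _)
  · rw [step, tsum_pure_mul, next_some]

lemma lintegral_law_succ (t : ℕ) (f : State n → ℝ≥0∞) :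
    ∫⁻ ω, f (ω (t + 1)) ∂A.law P = ∫⁻ ω, ∫⁻ x, f x ∂A.stepKernel P (ω t) ∂A.law P := by
  have hf : Measurable f := measurable_from_top
  have key := Kernel.map_frestrictLe_trajMeasure_compProd_eq_map_trajMeasure
    (X := fun _ => State n) (μ₀ := Measure.dirac ⟨[], none⟩)
    (κ := fun t => (A.stepKernel P).comap
      (fun ω : (i : Finset.Iic t) → State n => ω ⟨t, Finset.mem_Iic.2 le_rfl⟩)
      (measurable_pi_apply _)) (a := t)
  have h := congrArg (fun μ => ∫⁻ y, f y.2 ∂μ) key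
  beta_reduce at h
  have hg : Measurable fun y : ((i : Finset.Iic t) → State n) × State n => f y.2 :=
    hf.comp measurable_snd
  rw [Measure.lintegral_compProd hg, lintegral_map hg (by fun_prop),
    lintegral_map (Measurable.lintegral_kernel_prod_right' hg) (by fun_prop)] at h
  exact h.symm

lemma lintegral_law_zero (f : State n → ℝ≥0∞) :
    ∫⁻ ω, f (ω 0) ∂A.law P = f ⟨[], none⟩ := by
  have hf : Measurable f := measurable_from_top
  have h0 : (fun ω : ℕ → State n => f (ω 0)) =
      fun ω => (fun x : (i : Finset.Iic 0) → State n => f (x ⟨0, by simp⟩))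
        (Preorder.frestrictLe (π := fun _ => State n) 0 ω) := rfl
  rw [h0, ← lintegral_map (f := fun x : (i : Finset.Iic 0) → State n => f (x ⟨0, by simp⟩))
    (hf.comp (measurable_pi_apply _)) (Preorder.measurable_frestrictLe 0), law,
    Kernel.trajMeasure, Measure.map_comp _ _ (by fun_prop), Kernel.traj_map_frestrictLe,
    Kernel.partialTraj_self, Measure.id_comp,
    lintegral_map (f := fun x : (i : Finset.Iic 0) → State n => f (x ⟨0, by simp⟩))
      (hf.comp (measurable_pi_apply _)) (by fun_prop), lintegral_dirac' _ measurable_from_top]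
  rfl

/-- The bridge from the path measure to the one-step operator: afterwards only finite sums over
iterates of `next` are needed. -/
lemma lintegral_law (t : ℕ) {f : State n → ℝ} (hf : 0 ≤ f) :
    ∫⁻ ω, ENNReal.ofReal (f (ω t)) ∂A.law P = ENNReal.ofReal (A.expect P t f) := by
  induction t generalizing f with
  | zero => exact A.lintegral_law_zero P fun s => ENNReal.ofReal (f s)
  | succ t ih =>
    rw [A.lintegral_law_succ P t fun s => ENNReal.ofReal (f s)]
    simp_rw [A.lintegral_stepKernel P hf]
    rw [ih (A.next_nonneg P hf)]
    rfl

end Learner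

/-! ### Change of measure -/

/-- The sum of `c (i, j) o` over all rounds of a history. -/
def rewardSum {n : ℕ} (c : Fin n × Fin n → Outcome → ℝ) (s : State n) : ℝ :=
  (s.history.map fun r => c r.1 r.2).sum

lemma rewardSum_cons {n : ℕ} (c : Fin n × Fin n → Outcome → ℝ) (x : Fin n × Fin n) (o : Outcome)
    (h : List (Round n)) (b : Option (Fin n)) (b' : Option (Fin n)) :
    rewardSum c ⟨(x, o) :: h, b⟩ = c x o + rewardSum c ⟨h, b'⟩ := by
  simp [rewardSum]

lemma rewardSum_one {n : ℕ} (s : State n) : rewardSum (fun _ _ => 1) s = s.history.length := by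
  simp [rewardSum]

/-- The number of duels `x` in a history. -/
def duelCount {n : ℕ} (x : Fin n × Fin n) (s : State n) : ℝ :=
  rewardSum (fun y _ => if y = x then 1 else 0) s

/-- With `b x` the mean of `c x`, this splits the reward into a martingale and a combination of duel
counts, which is Wald's identity in the making. -/
lemma rewardSum_eq_add {n : ℕ} (c : Fin n × Fin n → Outcome → ℝ) (b : Fin n × Fin n → ℝ) :
    rewardSum c = rewardSum (fun x o => c x o - b x) + ∑ x, b x • duelCount x := by
  ext ⟨h, o⟩
  simp only [Pi.add_apply, Finset.sum_apply, Pi.smul_apply, smul_eq_mul, duelCount, rewardSum]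
  induction h with
  | nil => simp
  | cons r h ih =>
    simp only [List.map_cons, List.sum_cons, mul_add, Finset.sum_add_distrib, mul_ite, mul_one,
      mul_zero, Finset.sum_ite_eq, Finset.mem_univ, if_true] at ih ⊢
    rw [ih]
    ring

namespace Instance

variable {n : ℕ} (P : Instance n)

/-- The expectation of `f` under the outcome distribution of the duel `x`. -/
def mean (x : Fin n × Fin n) (f : Outcome → ℝ) : ℝ := ∑ o, P.prob o x.1 x.2 * f o

lemma mean_const (x : Fin n × Fin n) (a : ℝ) : P.mean x (fun _ => a) = a := by
  rw [mean, ← Finset.sum_mul, sum_outcome, P.prob_sum, one_mul]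

lemma mean_add (x : Fin n × Fin n) (f g : Outcome → ℝ) :
    P.mean x (fun o => f o + g o) = P.mean x f + P.mean x g := by
  simp [mean, mul_add, Finset.sum_add_distrib]

lemma mean_sub_const (x : Fin n × Fin n) (f : Outcome → ℝ) (a : ℝ) :
    P.mean x (fun o => f o - a) = P.mean x f - a := by
  simpa [sub_eq_add_neg, mean_const] using P.mean_add x f fun _ => -a

end Instance

namespace Learner

variable {n : ℕ} (A : Learner n) (P P' : Instance n)

lemma sum_policy (h : List (Round n)) :
    ∑ x, (A.policy h (.inl x)).toReal + ∑ i, (A.policy h (.inr i)).toReal = 1 := by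
  rw [← Fintype.sum_sum_type fun a => (A.policy h a).toReal,
    ← ENNReal.toReal_sum fun a _ => PMF.apply_ne_top _ _, ← tsum_fintype (L := .unconditional _),
    PMF.tsum_coe, ENNReal.toReal_one]

lemma next_none' (f : State n → ℝ) (h : List (Round n)) :
    A.next P f ⟨h, none⟩ = ∑ x : Fin n × Fin n,
        (A.policy h (.inl x)).toReal * P.mean x (fun o => f ⟨(x, o) :: h, none⟩) +
      ∑ i, (A.policy h (.inr i)).toReal * f ⟨h, some i⟩ := rfl

/-- `Learner.next` as a linear map. -/
def nextLinear : Module.End ℝ (State n → ℝ) where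
  toFun := A.next P
  map_add' f g := by
    ext ⟨h, _ | i⟩
    · simp only [next_none', Pi.add_apply, Instance.mean_add, mul_add, Finset.sum_add_distrib]
      ring
    · rfl
  map_smul' a f := by
    ext ⟨h, _ | i⟩
    · simp only [next_none, Pi.smul_apply, smul_eq_mul, RingHom.id_apply, mul_add, Finset.mul_sum]
      congr 1 <;> refine Finset.sum_congr rfl fun _ _ => ?_
      · exact Finset.sum_congr rfl fun _ _ => by ring
      · ring
    · rfl

lemma expect_eq_linear (t : ℕ) (f : State n → ℝ) :
    A.expect P t f = (A.nextLinear P ^ t) f ⟨[], none⟩ := by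
  rw [Module.End.pow_apply]
  rfl

lemma expect_add (t : ℕ) (f g : State n → ℝ) :
    A.expect P t (f + g) = A.expect P t f + A.expect P t g := by
  simp [expect_eq_linear]

lemma expect_sub (t : ℕ) (f g : State n → ℝ) :
    A.expect P t (f - g) = A.expect P t f - A.expect P t g := by
  simp [expect_eq_linear]

lemma expect_smul (t : ℕ) (a : ℝ) (f : State n → ℝ) :
    A.expect P t (a • f) = a * A.expect P t f := by
  simp [expect_eq_linear]

lemma expect_sum {ι : Type*} (u : Finset ι) (t : ℕ) (f : ι → State n → ℝ) :
    A.expect P t (∑ i ∈ u, f i) = ∑ i ∈ u, A.expect P t (f i) := by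
  simp [expect_eq_linear, Finset.sum_apply]

lemma expect_mono (t : ℕ) {f g : State n → ℝ} (hfg : f ≤ g) :
    A.expect P t f ≤ A.expect P t g := by
  have h : Monotone (A.next P) := fun _ _ => A.next_mono P
  exact h.iterate t hfg _

lemma expect_of_fixed (t : ℕ) {f : State n → ℝ} (hf : A.next P f = f) :
    A.expect P t f = f ⟨[], none⟩ := by
  rw [expect, Function.iterate_fixed hf]

lemma expect_one (t : ℕ) : A.expect P t 1 = 1 := by
  refine A.expect_of_fixed P t ?_
  ext ⟨h, _ | i⟩
  · simpa [next_none', Instance.mean_const] using A.sum_policy h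
  · rfl

lemma next_rewardSum {c : Fin n × Fin n → Outcome → ℝ} (hc : ∀ x, P.mean x (c x) = 0) :
    A.next P (rewardSum c) = rewardSum c := by
  ext ⟨h, _ | i⟩
  · have h1 : ∀ x, P.mean x (fun o => rewardSum c ⟨(x, o) :: h, none⟩) =
        rewardSum c ⟨h, none⟩ := fun x => by
      simp_rw [rewardSum_cons c _ _ h none none]
      rw [P.mean_add, hc, P.mean_const, zero_add]
    have h2 : ∀ i, rewardSum c ⟨h, some i⟩ = rewardSum c ⟨h, none⟩ := fun i => rfl
    simp only [next_none', h1, h2]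
    rw [← Finset.sum_mul, ← Finset.sum_mul, ← add_mul, A.sum_policy, one_mul]
  · rfl

/-- The expected number of duels `x` in the first `t` steps. -/
def visits (t : ℕ) (x : Fin n × Fin n) : ℝ := A.expect P t (duelCount x)

lemma visits_nonneg (t : ℕ) (x : Fin n × Fin n) : 0 ≤ A.visits P t x := by
  have h : (0 : State n → ℝ) ≤ duelCount x := fun s => by
    refine List.sum_nonneg fun a ha => ?_
    obtain ⟨r, -, rfl⟩ := List.mem_map.1 ha
    dsimp only
    split_ifs <;> norm_num
  have h0 : A.expect P t 0 = 0 := by simp [expect_eq_linear]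
  exact h0 ▸ A.expect_mono P t h

/-- Wald's identity. -/
lemma expect_rewardSum (t : ℕ) (c : Fin n × Fin n → Outcome → ℝ) :
    A.expect P t (rewardSum c) = ∑ x, P.mean x (c x) * A.visits P t x := by
  rw [rewardSum_eq_add c fun x => P.mean x (c x), expect_add, expect_sum]
  simp_rw [expect_smul]
  rw [A.expect_of_fixed P t (A.next_rewardSum P fun x => by rw [P.mean_sub_const, sub_self])]
  simp [rewardSum, visits]

lemma sum_visits (t : ℕ) :
    ∑ x, A.visits P t x = A.expect P t fun s => (s.history.length : ℝ) := by
  have h := A.expect_rewardSum P t fun _ _ => 1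
  simp_rw [P.mean_const, one_mul] at h
  rw [← h]
  congr 1
  ext s
  exact rewardSum_one s

/-- The learner can only be unfinished after `t` steps if it has made `t` duels. -/
lemma mul_expect_unfinished_le (t : ℕ) :
    t * A.expect P t (fun s => if s.output = none then 1 else 0) ≤
      A.expect P t fun s => (s.history.length : ℝ) := by
  -- Each step adds a duel or stops, so `next` maps `g (k + 1)` below `g k`. After `t` steps `g t`
  -- has expectation at most `g 0` at the start, which is 0.
  let g : ℕ → State n → ℝ := fun k s => (if s.output = none then (k : ℝ) else 0) - s.history.length
  have hg : ∀ k, A.next P (g (k + 1)) ≤ g k := by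
    rintro k ⟨h, _ | i⟩
    · simp only [next_none', g, if_true, reduceCtorEq, if_false, List.length_cons, P.mean_const]
      rw [← Finset.sum_mul, ← Finset.sum_mul]
      have h1 := A.sum_policy h
      have h2 : 0 ≤ ∑ i, (A.policy h (.inr i)).toReal :=
        Finset.sum_nonneg fun _ _ => ENNReal.toReal_nonneg
      rw [eq_sub_of_add_eq h1]
      push_cast
      nlinarith [mul_nonneg h2 k.cast_nonneg]
    · simp [next_some, g]
  have h : ∀ k, A.expect P t (g (t + k)) ≤ g k ⟨[], none⟩ := by
    induction t with
    | zero => intro k; rw [zero_add]; rfl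
    | succ t ih =>
      intro k
      refine le_trans (A.expect_mono P t (f := A.next P (g (t + 1 + k))) ?_) (ih k)
      rw [add_right_comm]
      exact hg _
  have h0 := h 0
  have e : g (t + 0) = (t : ℝ) • (fun s : State n => if s.output = none then (1 : ℝ) else 0) -
      fun s : State n => (s.history.length : ℝ) := by
    ext s
    simp [g]
  rw [e, expect_sub, expect_smul] at h0
  simpa [g] using h0

variable {P P'} in
-- Multiplication by the likelihood ratio intertwines the two one-step operators: a new round
-- contributes the factor `exp (-c)`, which turns the probabilities of `P` into those of `P'`, while
-- the policy is common to both. The empty history has weight 1.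
lemma expect_change_of_measure {c : Fin n × Fin n → Outcome → ℝ}
    (hc : ∀ (x : Fin n × Fin n) o, P'.prob o x.1 x.2 = P.prob o x.1 x.2 * Real.exp (-c x o))
    (t : ℕ) (f : State n → ℝ) :
    A.expect P' t f = A.expect P t fun s => Real.exp (-rewardSum c s) * f s := by
  have h : Function.Semiconj (fun (f : State n → ℝ) s => Real.exp (-rewardSum c s) * f s)
      (A.next P') (A.next P) := by
    intro f
    ext ⟨h, _ | i⟩
    · simp only [next_none, mul_add, Finset.mul_sum]
      congr 1
      · refine Finset.sum_congr rfl fun x _ => Finset.sum_congr rfl fun o _ => ?_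
        rw [rewardSum_cons c _ _ h none none, neg_add, Real.exp_add, hc]
        ring
      · refine Finset.sum_congr rfl fun i _ => ?_
        have : rewardSum c ⟨h, some i⟩ = rewardSum c ⟨h, none⟩ := rfl
        rw [this]
        ring
    · rfl
  have h1 := congrFun (h.iterate_right t f) ⟨[], none⟩
  simp only [rewardSum, List.map_nil, List.sum_nil, neg_zero, Real.exp_zero, one_mul] at h1
  exact h1

variable {P P'} in
/-- The transportation inequality: the Gibbs variational principle for the log-likelihood ratio. -/
lemma le_sum_visits_mul_mean {c : Fin n × Fin n → Outcome → ℝ}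
    (hc : ∀ (x : Fin n × Fin n) o, P'.prob o x.1 x.2 = P.prob o x.1 x.2 * Real.exp (-c x o))
    {δ : ℝ} (h0 : 0 < δ) (h1 : δ ≤ 1 / 2) (t : ℕ) (i : Fin n)
    (hq : A.expect P' t (fun s => if s.output = some i then 1 else 0) ≤ δ) :
    (2 * A.expect P t (fun s => if s.output = some i then 1 else 0) - 1) *
      Real.log ((1 - δ) / δ) ≤ ∑ x, P.mean x (c x) * A.visits P t x := by
  set Λ := Real.log ((1 - δ) / δ)
  set E : State n → ℝ := fun s => if s.output = some i then 1 else 0 with hE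
  have hδ : 0 < 1 - δ := by linarith
  have e1 : Real.exp Λ = (1 - δ) / δ := Real.exp_log (by positivity)
  have e2 : Real.exp (-Λ) = δ / (1 - δ) := by rw [Real.exp_neg, e1, inv_div]
  -- The test function is `Λ` on the event and `-Λ` off it. The expectation of its exponential under
  -- `P'` is increasing in the probability of the event because `δ ≤ 1/2`, and equals 1 when that
  -- probability is `δ`.
  let φ : State n → ℝ := (2 * Λ) • E - Λ • 1
  have h2 : A.expect P' t (fun s => Real.exp (φ s)) ≤ 1 := by
    have e : (fun s => Real.exp (φ s)) =
        (Real.exp Λ - Real.exp (-Λ)) • E + Real.exp (-Λ) • (1 : State n → ℝ) := by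
      ext s
      by_cases hs : s.output = some i
      · simp [φ, hE, hs]; ring
      · simp [φ, hE, hs]
    have h3 : 0 ≤ (1 - δ) / δ - δ / (1 - δ) := by
      rw [sub_nonneg, div_le_div_iff₀ hδ h0]
      nlinarith
    rw [e, expect_add, expect_smul, expect_smul, expect_one, e1, e2]
    calc _ ≤ ((1 - δ) / δ - δ / (1 - δ)) * δ + δ / (1 - δ) * 1 := by gcongr
      _ = 1 := by field_simp; ring
  rw [A.expect_change_of_measure hc] at h2
  -- The inequality `1 + x ≤ exp x` takes the place of Jensen's inequality.
  have h3 : A.expect P t (1 + φ - rewardSum c) ≤ 1 := by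
    refine (A.expect_mono P t fun s => ?_).trans h2
    rw [← Real.exp_add]
    have := Real.add_one_le_exp (-rewardSum c s + φ s)
    simp only [Pi.sub_apply, Pi.add_apply, Pi.one_apply]
    linarith
  rw [expect_sub, expect_add, expect_one, expect_rewardSum, expect_sub, expect_smul, expect_smul,
    expect_one] at h3
  linarith

/-! ### Output probabilities of a correct learner -/

lemma ofReal_expect_indicator (t : ℕ) (B : Set (State n)) :
    ENNReal.ofReal (A.expect P t (B.indicator 1)) = A.law P {ω | ω t ∈ B} := by
  have h0 : 0 ≤ B.indicator (1 : State n → ℝ) := fun s => Set.indicator_nonneg (by simp) s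
  rw [← A.lintegral_law P t h0]
  have hm : MeasurableSet {ω : ℕ → State n | ω t ∈ B} :=
    measurable_pi_apply t (show MeasurableSet B from trivial)
  rw [← lintegral_indicator_one hm]
  congr 1
  ext ω
  by_cases h : ω t ∈ B
  · rw [Set.indicator_of_mem h, Set.indicator_of_mem (s := {ω : ℕ → State n | ω t ∈ B}) h]
    simp
  · rw [Set.indicator_of_notMem h, Set.indicator_of_notMem (s := {ω : ℕ → State n | ω t ∈ B}) h]
    simp

variable {A P} in
lemma IsCorrectAt.expect_le {δ : ℝ} (hδ : 0 ≤ δ) (h : A.IsCorrectAt P δ) (t : ℕ) :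
    A.expect P t ({s | ∃ i, s.output = some i ∧ i ∉ P.copelandSet}.indicator 1) ≤ δ := by
  rw [← ENNReal.ofReal_le_ofReal_iff hδ, ofReal_expect_indicator]
  exact (measure_mono fun ω (hω : ∃ i, _) => (⟨t, hω⟩ : ∃ t, ∃ i, _)).trans h

variable {A P} in
lemma IsCorrectAt.expect_output_le {δ : ℝ} (hδ : 0 ≤ δ) (h : A.IsCorrectAt P δ) (t : ℕ) {i : Fin n}
    (hi : i ∉ P.copelandSet) : A.expect P t (fun s => if s.output = some i then 1 else 0) ≤ δ := by
  refine (A.expect_mono P t fun s => ?_).trans (h.expect_le hδ t)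
  by_cases hs : s.output = some i
  · rw [if_pos hs, Set.indicator_of_mem
      (s := {s : State n | ∃ i, s.output = some i ∧ i ∉ P.copelandSet}) ⟨i, hs, hi⟩]
    exact le_rfl
  · rw [if_neg hs]
    exact Set.indicator_nonneg (by simp) _

lemma expect_length_le (hR : A.expectedSamples P ≠ ⊤) (t : ℕ) :
    A.expect P t (fun s => (s.history.length : ℝ)) ≤ (A.expectedSamples P).toReal := by
  rw [← ENNReal.ofReal_le_iff_le_toReal hR, ← A.lintegral_law P t fun _ => Nat.cast_nonneg _]
  refine lintegral_mono fun ω => ?_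
  rw [ENNReal.ofReal_natCast]
  have := ENat.toENNReal_le.2 (le_iSup (fun t => ((ω t).history.length : ℕ∞)) t)
  exact le_trans (by simp) this

variable {A P} in
-- After `t` steps the learner has returned `i`, has returned a wrong arm, or is unfinished; the
-- last case has probability at most `𝔼[τ] / t` by Markov's inequality.
lemma IsCorrectAt.le_expect_output {δ : ℝ} (hδ : 0 ≤ δ) (h : A.IsCorrectAt P δ) {t : ℕ}
    (ht : 0 < t) {i : Fin n} (hi : P.copelandSet = {i}) (hR : A.expectedSamples P ≠ ⊤) :
    1 - δ - (A.expectedSamples P).toReal / t ≤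
      A.expect P t (fun s => if s.output = some i then 1 else 0) := by
  have h1 := h.expect_le hδ t
  have h2 := (A.mul_expect_unfinished_le P t).trans (A.expect_length_le P hR t)
  rw [mul_comm, ← le_div_iff₀ (by exact_mod_cast ht)] at h2
  have e : (1 : State n → ℝ) = (fun s => if s.output = some i then (1 : ℝ) else 0) +
      (fun s => if s.output = none then 1 else 0) +
      {s | ∃ i, s.output = some i ∧ i ∉ P.copelandSet}.indicator 1 := by
    ext ⟨h, _ | k⟩
    · simp
    · by_cases hk : k = i <;> simp [hk, hi]
  have h3 := A.expect_one P t
  rw [e, expect_add, expect_add] at h3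
  linarith

end Learner

/-! ### Copeland scores -/

/-- The observation of the duel `(j, i)` that corresponds to the given one of `(i, j)`. -/
def Outcome.swap : Outcome → Outcome
  | .succ => .prec
  | .indiff => .indiff
  | .prec => .succ

namespace Instance

variable {n : ℕ} (P : Instance n)

lemma prob_swap (o : Outcome) (i j : Fin n) : P.prob o.swap j i = P.prob o i j := by
  have h1 := P.prob_symm i j
  have h2 := P.prob_symm j i
  have h3 := P.prob_sum i j
  have h4 := P.prob_sum j i
  cases o <;> simp only [Outcome.swap] <;> linarith

lemma mem_L {i j : Fin n} : i ∈ P.L j ↔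
    i ≠ j ∧ P.prob .prec i j < P.prob .succ i j ∧ P.prob .indiff i j < P.prob .succ i j := by
  simp [L]

lemma mem_I {i j : Fin n} : i ∈ P.I j ↔
    i ≠ j ∧ P.prob .prec i j < P.prob .indiff i j ∧ P.prob .succ i j < P.prob .indiff i j := by
  simp [I]

lemma mem_L' {i j : Fin n} : i ∈ P.L j ↔
    i ≠ j ∧ P.prob .succ j i < P.prob .prec j i ∧ P.prob .indiff j i < P.prob .prec j i := by
  rw [mem_L, ← P.prob_swap .prec, ← P.prob_swap .succ, ← P.prob_swap .indiff]
  rfl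

lemma mem_I' {i j : Fin n} : i ∈ P.I j ↔
    i ≠ j ∧ P.prob .prec j i < P.prob .indiff j i ∧ P.prob .succ j i < P.prob .indiff j i := by
  rw [mem_I, ← P.prob_swap .prec, ← P.prob_swap .succ, ← P.prob_swap .indiff]
  simp only [Outcome.swap]
  tauto

lemma mem_I_comm {i j : Fin n} : i ∈ P.I j ↔ j ∈ P.I i := by
  rw [mem_I, mem_I', ne_comm]

lemma notMem_L_of_mem_L {i j : Fin n} (h : i ∈ P.L j) : j ∉ P.L i := by
  rw [mem_L] at h
  rw [mem_L']
  exact fun h' => absurd h.2.1 h'.2.1.not_gt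

lemma notMem_I_of_mem_L {i j : Fin n} (h : i ∈ P.L j) : i ∉ P.I j := by
  rw [mem_L] at h
  rw [mem_I]
  exact fun h' => absurd h.2.2 h'.2.2.not_gt

lemma disjoint_L_I (j : Fin n) : Disjoint (P.L j) (P.I j) :=
  Finset.disjoint_left.2 fun _ => P.notMem_I_of_mem_L

open Classical in
/-- The contribution of the comparison with `j` to the Copeland score of `i`. -/
def point (i j : Fin n) : ℝ := if i ∈ P.L j then 1 else if i ∈ P.I j then 1 / 2 else 0

lemma point_of_mem_L {i j : Fin n} (h : i ∈ P.L j) : P.point i j = 1 := if_pos h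

lemma point_of_mem_I {i j : Fin n} (h : i ∈ P.I j) : P.point i j = 1 / 2 := by
  rw [point, if_neg fun h' => P.notMem_I_of_mem_L h' h, if_pos h]

lemma point_of_notMem {i j : Fin n} (h : i ∉ P.L j ∪ P.I j) : P.point i j = 0 := by
  rw [Finset.mem_union, not_or] at h
  rw [point, if_neg h.1, if_neg h.2]

lemma point_of_mem_L' {i j : Fin n} (h : j ∈ P.L i) : P.point i j = 0 := by
  refine P.point_of_notMem ?_
  rw [Finset.mem_union, not_or, P.mem_I_comm]
  exact ⟨P.notMem_L_of_mem_L h, P.notMem_I_of_mem_L h⟩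

lemma point_self (i : Fin n) : P.point i i = 0 :=
  P.point_of_notMem (by simp [mem_L, mem_I])

lemma point_le_one (i j : Fin n) : P.point i j ≤ 1 := by
  rw [point]
  split_ifs <;> norm_num

lemma point_congr {P' : Instance n} {i j : Fin n} (h : ∀ o, P'.prob o i j = P.prob o i j) :
    P'.point i j = P.point i j := by
  simp only [point, mem_L, mem_I, h]

lemma CP_eq_sum (i : Fin n) : P.CP i = ∑ j, P.point i j := by
  rw [CP, Finset.mul_sum, ← Finset.sum_add_distrib,
    ← Finset.add_sum_erase _ _ (Finset.mem_univ i), point_self, zero_add]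
  refine Finset.sum_congr rfl fun j hj => ?_
  have hij : i ≠ j := (Finset.ne_of_mem_erase hj).symm
  by_cases h : i ∈ P.L j
  · have h' := P.mem_L.1 h
    rw [point_of_mem_L _ h, if_pos (max_lt h'.2.1 h'.2.2),
      if_neg fun h'' => absurd ((le_max_left _ _).trans_lt h'') h'.2.2.not_gt]
    norm_num
  · have h1 : ¬ max (P.prob .prec i j) (P.prob .indiff i j) < P.prob .succ i j := fun h' =>
      h (P.mem_L.2 ⟨hij, max_lt_iff.1 h'⟩)
    by_cases h2 : i ∈ P.I j
    · have h' := P.mem_I.1 h2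
      rw [point_of_mem_I _ h2, if_neg h1, if_pos (max_lt h'.2.2 h'.2.1)]
      norm_num
    · have h3 : ¬ max (P.prob .succ i j) (P.prob .prec i j) < P.prob .indiff i j := fun h' =>
        h2 (P.mem_I.2 ⟨hij, (max_lt_iff.1 h').symm⟩)
      rw [point_of_notMem _ (by simp [h, h2]), if_neg h1, if_neg h3]
      norm_num

variable {P} in
lemma CP_le_of_copelandSet {i : Fin n} (h : P.copelandSet = {i}) (j : Fin n) : P.CP j ≤ P.CP i :=
  (h.symm ▸ Set.mem_singleton i : i ∈ P.copelandSet) j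

variable {P} in
lemma d_eq {i : Fin n} (h : P.copelandSet = {i}) (j : Fin n) : P.d j = P.CP i - P.CP j := by
  have : Nonempty (Fin n) := ⟨i⟩
  rw [d, le_antisymm (ciSup_le (CP_le_of_copelandSet h))
    (le_ciSup (Set.finite_range P.CP).bddAbove i)]

variable {P} in
lemma d_pos {i j : Fin n} (h : P.copelandSet = {i}) (hj : j ≠ i) : 0 < P.d j := by
  rw [d_eq h, sub_pos]
  by_contra hle
  refine hj (h ▸ ?_ : j ∈ ({i} : Set (Fin n)))
  exact fun k => (CP_le_of_copelandSet h k).trans (not_lt.1 hle)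

variable {P} in
lemma IsPositive.prob_pos (h : P.IsPositive) {i j : Fin n} (hij : i ≠ j) (o : Outcome) :
    0 < P.prob o i j := by
  rcases hij.lt_or_gt with hij | hij
  · exact h i j hij o
  · rw [← P.prob_swap]
    exact h j i hij _

variable {P} in
lemma HasUniqueModes.mem_or {i j : Fin n} (h : P.HasUniqueModes) (hij : i ≠ j) :
    i ∈ P.L j ∨ i ∈ P.I j ∨ j ∈ P.L i := by
  wlog hlt : i < j generalizing i j
  · have := this hij.symm (lt_of_le_of_ne (not_lt.1 hlt) hij.symm)
    rw [P.mem_I_comm]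
    tauto
  obtain ⟨o, ho⟩ := h i j hlt
  cases o
  · exact .inl (P.mem_L.2 ⟨hij, ho _ (by simp), ho _ (by simp)⟩)
  · exact .inr (.inl (P.mem_I.2 ⟨hij, ho _ (by simp), ho _ (by simp)⟩))
  · exact .inr (.inr (P.mem_L'.2 ⟨hij.symm, ho _ (by simp), ho _ (by simp)⟩))

variable {P} in
lemma HasUniqueModes.point_add {i j : Fin n} (h : P.HasUniqueModes) (hij : i ≠ j) :
    P.point i j + P.point j i = 1 := by
  rcases h.mem_or hij with h | h | h
  · rw [P.point_of_mem_L h, P.point_of_mem_L' h, add_zero]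
  · rw [P.point_of_mem_I h, P.point_of_mem_I (P.mem_I_comm.1 h)]
    norm_num
  · rw [P.point_of_mem_L h, P.point_of_mem_L' h, zero_add]

/-- The sum of the points that the other arms get from their comparisons with `j`. -/
lemma sum_point_left (j : Fin n) :
    ∑ i, P.point i j = (P.L j).card + 1 / 2 * (P.I j).card := by
  classical
  have h : ∀ i, P.point i j = (if i ∈ P.L j then (1 : ℝ) else 0) +
      1 / 2 * if i ∈ P.I j then (1 : ℝ) else 0 := fun i => by
    by_cases h1 : i ∈ P.L j
    · simp [point_of_mem_L _ h1, h1, P.notMem_I_of_mem_L h1]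
    · simp [point, h1]
  simp_rw [h, Finset.sum_add_distrib, ← Finset.mul_sum]
  simp

variable {P} in
-- With unique modes the points of a duel add up to 1, so `j` scores `n - 1` minus the points that
-- others take from it, while `i` scores at most `n - 2` outside its duel with `j`.
lemma HasUniqueModes.d_le (h : P.HasUniqueModes) {i j : Fin n} (hi : P.copelandSet = {i})
    (hj : j ≠ i) : P.d j + 1 ≤ (P.L j).card + 1 / 2 * (P.I j).card + P.point i j := by
  classical
  have h1 : P.CP j = ∑ z ∈ Finset.univ.erase j, (1 - P.point z j) := by
    rw [CP_eq_sum, ← Finset.add_sum_erase _ _ (Finset.mem_univ j), point_self, zero_add]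
    refine Finset.sum_congr rfl fun z hz => ?_
    linarith [h.point_add (Finset.ne_of_mem_erase hz)]
  have h2 : P.CP i ≤ P.point i j + ∑ z ∈ (Finset.univ.erase i).erase j, 1 := by
    rw [CP_eq_sum, ← Finset.add_sum_erase _ _ (Finset.mem_univ i), point_self, zero_add,
      ← Finset.add_sum_erase _ _ (Finset.mem_erase.2 ⟨hj, Finset.mem_univ j⟩)]
    gcongr
    exact P.point_le_one _ _
  have h3 := P.sum_point_left j
  rw [← Finset.add_sum_erase _ _ (Finset.mem_univ j), point_self, zero_add] at h3
  rw [Finset.sum_sub_distrib, h3] at h1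
  have h4 : ∑ z ∈ Finset.univ.erase j, (1 : ℝ) =
      1 + ∑ z ∈ (Finset.univ.erase i).erase j, (1 : ℝ) := by
    rw [Finset.erase_right_comm,
      Finset.add_sum_erase _ (fun _ => (1 : ℝ)) (Finset.mem_erase.2 ⟨hj.symm, Finset.mem_univ i⟩)]
  rw [d_eq hi]
  linarith

/-- The instance that arises from `P` when the outcome distributions of the duels `(j, z)` with
`z ∈ S` are replaced by `q z`. -/
def replace (j : Fin n) (S : Finset (Fin n)) (hj : j ∉ S) (q : Fin n → Outcome → ℝ)
    (hq : ∀ z ∈ S, ∀ o, 0 < q z o) (hq1 : ∀ z ∈ S, q z .succ + q z .indiff + q z .prec = 1) :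
    Instance n where
  prob o x y := if x = j ∧ y ∈ S then q y o else if y = j ∧ x ∈ S then q x o.swap else P.prob o x y
  prob_nonneg o x y := by
    split_ifs with h1 h2
    exacts [(hq y h1.2 o).le, (hq x h2.2 _).le, P.prob_nonneg o x y]
  prob_sum x y := by
    split_ifs with h1 h2
    · exact hq1 y h1.2
    · simp only [Outcome.swap]
      linarith [hq1 x h2.2]
    · exact P.prob_sum x y
  prob_symm x y := by
    by_cases h1 : x = j ∧ y ∈ S
    · have h2 : ¬ (y = j ∧ x ∈ S) := fun h => hj (h.1 ▸ h1.2)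
      rw [if_neg h2, if_pos h1, if_pos h1]
      rfl
    · by_cases h2 : y = j ∧ x ∈ S
      · rw [if_pos h2, if_neg h1, if_pos h2]
        rfl
      · rw [if_neg h1, if_neg h2, if_neg h1, if_neg h2]
        exact P.prob_symm x y

section Replace

variable {j : Fin n} {S : Finset (Fin n)} {hj : j ∉ S} {q : Fin n → Outcome → ℝ}
  {hq : ∀ z ∈ S, ∀ o, 0 < q z o} {hq1 : ∀ z ∈ S, q z .succ + q z .indiff + q z .prec = 1}

lemma replace_prob_left {z : Fin n} (hz : z ∈ S) (o : Outcome) :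
    (P.replace j S hj q hq hq1).prob o j z = q z o := if_pos ⟨rfl, hz⟩

lemma replace_prob_right {z : Fin n} (hz : z ∈ S) (o : Outcome) :
    (P.replace j S hj q hq hq1).prob o z j = q z o.swap := by
  rw [← prob_swap, replace_prob_left _ hz]

lemma replace_prob_of_not {x y : Fin n} (h1 : ¬ (x = j ∧ y ∈ S)) (h2 : ¬ (y = j ∧ x ∈ S))
    (o : Outcome) : (P.replace j S hj q hq hq1).prob o x y = P.prob o x y :=
  (if_neg h1).trans (if_neg h2)

variable (hm : ∀ z ∈ S, q z .indiff < q z .succ ∧ q z .prec < q z .succ)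
include hm

lemma mem_L_replace {z : Fin n} (hz : z ∈ S) : j ∈ (P.replace j S hj q hq hq1).L z := by
  rw [mem_L]
  simp only [replace_prob_left _ hz]
  exact ⟨fun h => hj (h ▸ hz), (hm z hz).2, (hm z hz).1⟩

/-- Keeps the alternative in the class on which the learner is assumed correct. -/
lemma HasUniqueModes.replace (h : P.HasUniqueModes) :
    (P.replace j S hj q hq hq1).HasUniqueModes := by
  intro x y hxy
  by_cases h1 : x = j ∧ y ∈ S
  · obtain ⟨rfl, hy⟩ := h1
    refine ⟨.succ, fun o ho => ?_⟩
    simp only [replace_prob_left _ hy]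
    cases o
    exacts [absurd rfl ho, (hm y hy).1, (hm y hy).2]
  · by_cases h2 : y = j ∧ x ∈ S
    · obtain ⟨rfl, hx⟩ := h2
      refine ⟨.prec, fun o ho => ?_⟩
      simp only [replace_prob_right _ hx]
      cases o
      exacts [(hm x hx).2, (hm x hx).1, absurd rfl ho]
    · simp only [P.replace_prob_of_not h1 h2]
      exact h x y hxy

/-- Winning against all of `S` raises the score of `j` by the first sum, and the score of `i`
changes only through its duel with `j`. -/
lemma notMem_copelandSet_replace {i : Fin n} (hij : i ≠ j)
    (hS : P.CP i - P.CP j < ∑ z ∈ S, (1 - P.point j z) + if i ∈ S then P.point i j else 0) :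
    i ∉ (P.replace j S hj q hq hq1).copelandSet := by
  classical
  have h1 : (P.replace j S hj q hq hq1).CP j = P.CP j + ∑ z ∈ S, (1 - P.point j z) := by
    rw [CP_eq_sum, CP_eq_sum, ← Finset.sum_filter_add_sum_filter_not Finset.univ (· ∈ S),
      ← Finset.sum_filter_add_sum_filter_not Finset.univ (· ∈ S) fun z => P.point j z]
    have e1 : ∀ z ∈ Finset.univ.filter (· ∈ S), (P.replace j S hj q hq hq1).point j z = 1 :=
      fun z hz => point_of_mem_L _ (P.mem_L_replace hm (Finset.mem_filter.1 hz).2)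
    have e2 : ∀ z ∈ Finset.univ.filter (· ∉ S),
        (P.replace j S hj q hq hq1).point j z = P.point j z := fun z hz =>
      P.point_congr fun o => P.replace_prob_of_not
        (fun h => (Finset.mem_filter.1 hz).2 h.2) (fun h => hj h.2) o
    rw [Finset.sum_congr rfl e1, Finset.sum_congr rfl e2, Finset.filter_mem_eq_inter,
      Finset.univ_inter, Finset.sum_sub_distrib]
    ring
  have h2 : (P.replace j S hj q hq hq1).CP i = P.CP i - if i ∈ S then P.point i j else 0 := by
    rw [CP_eq_sum, CP_eq_sum, ← Finset.add_sum_erase _ _ (Finset.mem_univ j),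
      ← Finset.add_sum_erase _ (fun z => P.point i z) (Finset.mem_univ j)]
    have e1 : ∀ z ∈ Finset.univ.erase j,
        (P.replace j S hj q hq hq1).point i z = P.point i z := fun z hz =>
      P.point_congr fun o => P.replace_prob_of_not
        (fun h => hij h.1) (fun h => Finset.ne_of_mem_erase hz h.1) o
    rw [Finset.sum_congr rfl e1]
    by_cases hi : i ∈ S
    · rw [if_pos hi, point_of_mem_L' _ (P.mem_L_replace hm hi)]
      ring
    · rw [if_neg hi, P.point_congr fun o => P.replace_prob_of_not
        (fun h => hij h.1) (fun h => hi h.2) o]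
      ring
  intro h
  have := h j
  rw [h1, h2] at this
  linarith

end Replace

end Instance

/-! ### Alternative instances -/

lemma KL_of_pos {K : Type*} [Fintype K] {p q : K → ℝ} (hp : ∀ k, 0 < p k) (hq : ∀ k, 0 < q k) :
    KL p q = ENNReal.ofReal (∑ k, p k * Real.log (p k / q k)) := by
  classical
  rw [KL, if_pos fun k hk => absurd hk (hq k).ne', Finset.filter_true_of_mem fun k _ => hp k]

lemma log_div_swap (a b : ℝ) : Real.log (a / b) = -Real.log (b / a) := by
  rw [← Real.log_inv, inv_div]

namespace Instance

variable {n : ℕ} {P : Instance n}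

/-- An exchange affects two coordinates, whose terms combine to `(b - a) ln (b / a)`. -/
lemma IsPositive.D_eq (h : P.IsPositive) {x y : Fin n} (hxy : x ≠ y) :
    P.D x y = ENNReal.ofReal (max
      ((P.prob .indiff x y - P.prob .succ x y) *
        Real.log (P.prob .indiff x y / P.prob .succ x y))
      ((P.prob .prec x y - P.prob .succ x y) *
        Real.log (P.prob .prec x y / P.prob .succ x y))) := by
  have h0 := h.prob_pos hxy
  have e : ∀ a b c : Outcome, ∀ k : Fin 3, 0 < ![P.prob a x y, P.prob b x y, P.prob c x y] k :=
    fun a b c k => by fin_cases k <;> exact h0 _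
  rw [D, KL_of_pos (e _ _ _) (e _ _ _), KL_of_pos (e _ _ _) (e _ _ _), ENNReal.ofReal_max]
  simp only [Fin.sum_univ_three, Matrix.cons_val_zero, Matrix.cons_val_one, Matrix.cons_val]
  rw [div_self (h0 .prec).ne', div_self (h0 .indiff).ne', Real.log_one,
    log_div_swap (P.prob .succ x y) (P.prob .indiff x y),
    log_div_swap (P.prob .succ x y) (P.prob .prec x y)]
  congr 2 <;> ring

lemma IsPositive.D_ne_top (h : P.IsPositive) {x y : Fin n} (hxy : x ≠ y) : P.D x y ≠ ⊤ := by
  rw [h.D_eq hxy]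
  exact ENNReal.ofReal_ne_top

lemma IsPositive.le_toReal_D_indiff (h : P.IsPositive) {x y : Fin n} (hxy : x ≠ y) :
    (P.prob .indiff x y - P.prob .succ x y) *
      Real.log (P.prob .indiff x y / P.prob .succ x y) ≤ (P.D x y).toReal := by
  rw [h.D_eq hxy, ENNReal.toReal_ofReal']
  exact (le_max_left _ _).trans (le_max_left _ _)

lemma IsPositive.le_toReal_D_prec (h : P.IsPositive) {x y : Fin n} (hxy : x ≠ y) :
    (P.prob .prec x y - P.prob .succ x y) *
      Real.log (P.prob .prec x y / P.prob .succ x y) ≤ (P.D x y).toReal := by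
  rw [h.D_eq hxy, ENNReal.toReal_ofReal']
  exact (le_max_right _ _).trans (le_max_left _ _)

lemma IsPositive.toReal_D_pos (h : P.IsPositive) {j z : Fin n} (hz : z ∈ P.L j ∪ P.I j) :
    0 < (P.D j z).toReal := by
  have key : ∀ a b : ℝ, 0 < a → a < b → 0 < (b - a) * Real.log (b / a) := fun a b ha hab =>
    mul_pos (sub_pos.2 hab) (Real.log_pos ((one_lt_div ha).2 hab))
  rcases Finset.mem_union.1 hz with hz | hz
  · rw [mem_L'] at hz
    exact (key _ _ (h.prob_pos hz.1.symm _) hz.2.1).trans_le (h.le_toReal_D_prec hz.1.symm)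
  · rw [mem_I'] at hz
    exact (key _ _ (h.prob_pos hz.1.symm _) hz.2.2).trans_le (h.le_toReal_D_indiff hz.1.symm)

/-- The outcome distribution of the duel of `j` and a superior or indifferent arm `z` can be replaced
by one with strict mode `≻`. A duel of two indifferent arms can count for both of them, so that the
factor `1 / 2` is needed for it. -/
lemma IsPositive.exists_alternative (h : P.IsPositive) {j z : Fin n} (hz : z ∈ P.L j ∪ P.I j) :
    ∃ q : Outcome → ℝ, (∀ o, 0 < q o) ∧ q .succ + q .indiff + q .prec = 1 ∧
      q .indiff < q .succ ∧ q .prec < q .succ ∧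
      P.mean (j, z) (fun o => Real.log (P.prob o j z / q o)) ≤
        P.point z j * (P.D j z).toReal := by
  have hs := P.prob_sum j z
  by_cases hI : z ∈ P.I j
  · have hm := P.mem_I'.1 hI
    have h0 := h.prob_pos hm.1.symm
    obtain ⟨s', e', r', hs', he', hr', h1, h2, h3, h4⟩ :=
      exists_mode_change (h0 .succ) (h0 .indiff) (h0 .prec) hs hm.2.2 hm.2.1
    refine ⟨fun o => Outcome.casesOn o s' e' r', fun o => by cases o <;> assumption, h1, h2, h3,
      ?_⟩
    rw [P.point_of_mem_I hI, mean, sum_outcome]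
    exact h4.trans (mul_le_mul_of_nonneg_left (h.le_toReal_D_indiff hm.1.symm) (by norm_num))
  · have hL := (Finset.mem_union.1 hz).resolve_right hI
    have hm := P.mem_L'.1 hL
    have h0 := h.prob_pos hm.1.symm
    -- Exchanging `≻` and `≺` moves the strict mode to `≻`; the weight is 1 here, so nothing cheaper
    -- is needed.
    refine ⟨fun o => P.prob o.swap j z, fun o => h0 _, ?_, hm.2.2, hm.2.1, ?_⟩
    · simp only [Outcome.swap]
      linarith
    · rw [P.point_of_mem_L hL, one_mul, mean, sum_outcome]
      refine le_of_eq_of_le ?_ (h.le_toReal_D_prec hm.1.symm)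
      simp only [Outcome.swap]
      rw [div_self (h0 .indiff).ne', Real.log_one, log_div_swap (P.prob .succ j z)]
      ring

end Instance

namespace Learner

variable {n : ℕ} {A : Learner n} {P : Instance n}

/-- The expected number of duels of `i` and `j`, in either order, in the first `t` steps. -/
def pairVisits (A : Learner n) (P : Instance n) (t : ℕ) (i j : Fin n) : ℝ :=
  A.visits P t (i, j) + A.visits P t (j, i)

lemma pairVisits_nonneg (t : ℕ) (i j : Fin n) : 0 ≤ A.pairVisits P t i j :=
  add_nonneg (A.visits_nonneg P t _) (A.visits_nonneg P t _)

/-- The transportation inequality for the alternative in which `j` beats all arms of `S`. -/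
lemma le_sum_point_mul_pairVisits {𝓜 : Set (Instance n)}
    (h𝓜 : 𝓜 = Set.univ ∨ 𝓜 = {P | P.HasUniqueModes}) {δ : ℝ} (h0 : 0 < δ) (h1 : δ ≤ 1 / 2)
    (hA : ∀ P ∈ 𝓜, A.IsCorrectAt P δ) (hP : P ∈ 𝓜) (hpos : P.IsPositive) {i : Fin n}
    (hi : P.copelandSet = {i}) (hR : A.expectedSamples P ≠ ⊤) {t : ℕ} (ht : 0 < t) {j : Fin n}
    (hj : j ≠ i) {S : Finset (Fin n)} (hS : S ⊆ P.L j ∪ P.I j)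
    (hd : P.d j < ∑ z ∈ S, (1 - P.point j z) + if i ∈ S then P.point i j else 0) :
    (1 - 2 * δ - 2 * ((A.expectedSamples P).toReal / t)) * Real.log ((1 - δ) / δ) ≤
      ∑ z ∈ S, P.point z j * (P.D j z).toReal * A.pairVisits P t j z := by
  classical
  have hjS : j ∉ S := fun h => by
    have := hS h
    simp [Instance.mem_L, Instance.mem_I] at this
  choose! q hq hq1 hm1 hm2 hKL using
    fun z (hz : z ∈ P.L j ∪ P.I j) => hpos.exists_alternative hz
  let P' := P.replace j S hjS q (fun z hz => hq z (hS hz)) (fun z hz => hq1 z (hS hz))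
  have hm : ∀ z ∈ S, q z .indiff < q z .succ ∧ q z .prec < q z .succ :=
    fun z hz => ⟨hm1 z (hS hz), hm2 z (hS hz)⟩
  have hP' : P' ∈ 𝓜 := by
    rcases h𝓜 with rfl | rfl
    · trivial
    · exact Instance.HasUniqueModes.replace P hm hP
  have hi' : i ∉ P'.copelandSet := P.notMem_copelandSet_replace hm hj.symm
    (by rwa [← Instance.d_eq hi])
  -- Unchanged duels get `c = 0` even at outcomes of probability 0, possible for a duel of an arm
  -- with itself, since `Real.log (0 / 0) = 0`.
  let c : Fin n × Fin n → Outcome → ℝ := fun x o =>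
    Real.log (P.prob o x.1 x.2 / P'.prob o x.1 x.2)
  have hleft : ∀ z ∈ S, ∀ o, P'.prob o j z = q z o := fun z hz o => P.replace_prob_left hz o
  have hright : ∀ z ∈ S, ∀ o, P'.prob o z j = q z o.swap := fun z hz o =>
    P.replace_prob_right hz o
  have hother : ∀ x y, ¬ (x = j ∧ y ∈ S) → ¬ (y = j ∧ x ∈ S) → ∀ o,
      P'.prob o x y = P.prob o x y := fun x y h1 h2 o => P.replace_prob_of_not h1 h2 o
  have hc : ∀ (x : Fin n × Fin n) o,
      P'.prob o x.1 x.2 = P.prob o x.1 x.2 * Real.exp (-c x o) := by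
    rintro ⟨x, y⟩ o
    have key : ∀ p p' : ℝ, 0 < p → 0 < p' → p' = p * Real.exp (-Real.log (p / p')) :=
      fun p p' hp hp' => by
        rw [Real.exp_neg, Real.exp_log (div_pos hp hp')]
        field_simp
    by_cases h1 : x = j ∧ y ∈ S
    · obtain ⟨rfl, hy⟩ := h1
      refine key _ _ (hpos.prob_pos (ne_of_mem_of_not_mem hy hjS).symm o) ?_
      rw [hleft y hy]
      exact hq y (hS hy) o
    · by_cases h2 : y = j ∧ x ∈ S
      · obtain ⟨rfl, hx⟩ := h2
        refine key _ _ (hpos.prob_pos (ne_of_mem_of_not_mem hx hjS) o) ?_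
        rw [hright x hx]
        exact hq x (hS hx) _
      · simp only [c, hother x y h1 h2]
        by_cases hp : P.prob o x y = 0
        · simp [hp]
        · simp [div_self hp]
  have main := A.le_sum_visits_mul_mean hc h0 h1 t i
    ((hA P' hP').expect_output_le h0.le t hi')
  have hp := (hA P hP).le_expect_output h0.le ht hi hR
  have hΛ : 0 ≤ Real.log ((1 - δ) / δ) :=
    Real.log_nonneg ((one_le_div h0).2 (by linarith))
  have hmean : ∀ x : Fin n × Fin n, P.mean x (c x) * A.visits P t x =
      (if x.1 = j then if x.2 ∈ S then P.mean (j, x.2) (c (j, x.2)) * A.visits P t (j, x.2) else 0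
        else 0) +
      (if x.2 = j then if x.1 ∈ S then P.mean (x.1, j) (c (x.1, j)) * A.visits P t (x.1, j) else 0
        else 0) := by
    rintro ⟨x, y⟩
    by_cases h1 : x = j ∧ y ∈ S
    · obtain ⟨rfl, hy⟩ := h1
      simp [hy, hjS]
    · by_cases h2 : y = j ∧ x ∈ S
      · obtain ⟨rfl, hx⟩ := h2
        simp [hx, hjS]
      · have h3 : P.mean (x, y) (c (x, y)) = 0 := by
          refine Finset.sum_eq_zero fun o _ => ?_
          simp only [c, hother x y h1 h2]
          by_cases hp : P.prob o x y = 0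
          · simp [hp]
          · simp [div_self hp]
        rw [not_and] at h1 h2
        rw [h3, zero_mul]
        simp only
        split_ifs <;> simp_all
  have hsum : ∑ x, P.mean x (c x) * A.visits P t x =
      ∑ z ∈ S, (P.mean (j, z) (c (j, z)) * A.visits P t (j, z) +
        P.mean (z, j) (c (z, j)) * A.visits P t (z, j)) := by
    rw [Finset.sum_congr rfl fun x _ => hmean x, Finset.sum_add_distrib,
      Finset.sum_add_distrib, Fintype.sum_prod_type_right, Fintype.sum_prod_type]
    simp only [Finset.sum_ite_eq', Finset.mem_univ, if_true, Finset.sum_ite_mem,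
      Finset.univ_inter]
  rw [hsum] at main
  -- The factor is `2p - 1` with `p ≥ 1 - δ - 𝔼[τ] / t`.
  refine (mul_le_mul_of_nonneg_right ?_ hΛ).trans (main.trans (Finset.sum_le_sum fun z hz => ?_))
  · linarith
  · have e1 : P.mean (j, z) (c (j, z)) ≤ P.point z j * (P.D j z).toReal := by
      simp only [c, hleft z hz]
      exact hKL z (hS hz)
    have e2 : P.mean (z, j) (c (z, j)) = P.mean (j, z) (c (j, z)) := by
      simp only [Instance.mean, c, hleft z hz, hright z hz, sum_outcome, Outcome.swap]
      rw [← P.prob_swap .succ j z, ← P.prob_swap .indiff j z, ← P.prob_swap .prec j z]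
      simp only [Outcome.swap]
      ring
    rw [e2, ← mul_add]
    exact mul_le_mul_of_nonneg_right e1 (pairVisits_nonneg t j z)

end Learner

/-! ### Averaging over the alternatives -/

section Averaging

variable {α : Type*} [DecidableEq α]

/-- By Pascal's rule, after removing the sets that avoid `z`. -/
lemma card_filter_mem_powersetCard {A : Finset α} {z : α} (hz : z ∈ A) (i : ℕ) :
    ((A.powersetCard i).filter (z ∈ ·)).card =
      if 1 ≤ i then (A.card - 1).choose (i - 1) else 0 := by
  have h1 : (A.powersetCard i).filter (z ∉ ·) = (A.erase z).powersetCard i := by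
    ext s
    simp only [Finset.mem_filter, Finset.mem_powersetCard, Finset.subset_erase]
    tauto
  have h2 := Finset.card_filter_add_card_filter_not (s := A.powersetCard i) (z ∈ ·)
  rw [h1, Finset.card_powersetCard, Finset.card_powersetCard, Finset.card_erase_of_mem hz] at h2
  obtain ⟨a, ha⟩ := Nat.exists_eq_succ_of_ne_zero (Finset.card_ne_zero_of_mem hz)
  rw [ha] at h2 ⊢
  cases i with
  | zero => simp
  | succ i =>
    rw [Nat.choose_succ_succ] at h2
    simpa using h2

lemma sum_powersetCard_sum (A : Finset α) (i : ℕ) (x : α → ℝ) :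
    ∑ s ∈ A.powersetCard i, ∑ z ∈ s, x z =
      ((if 1 ≤ i then (A.card - 1).choose (i - 1) else 0 : ℕ) : ℝ) * ∑ z ∈ A, x z := by
  have h1 : ∀ s ∈ A.powersetCard i, ∑ z ∈ s, x z = ∑ z ∈ A, if z ∈ s then x z else 0 := by
    intro s hs
    rw [Finset.sum_ite_mem, Finset.inter_eq_right.2 (Finset.mem_powersetCard.1 hs).1]
  rw [Finset.sum_congr rfl h1, Finset.sum_comm, Finset.mul_sum]
  refine Finset.sum_congr rfl fun z hz => ?_
  rw [← Finset.sum_filter, Finset.sum_const, card_filter_mem_powersetCard hz, nsmul_eq_mul]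

/-- If `κ` is at most `y` plus the sum of `x` over any `i` elements of `A` and any `l` elements of
`B`, then averaging bounds `κ` in terms of the sum over all of `A` and `B`. -/
lemma choose_div_mul_le {A B : Finset α} {x : α → ℝ} (hx : ∀ z, 0 ≤ x z) {y κ : ℝ} (hy : 0 ≤ y)
    {i l e : ℕ} (he : ((A.card.choose i * B.card.choose l : ℕ) : ℝ) * y ≤ e * y)
    (h : ∀ s ∈ A.powersetCard i, ∀ t ∈ B.powersetCard l, κ ≤ y + ∑ z ∈ s, x z + ∑ z ∈ t, x z) :
    ((A.card.choose i * B.card.choose l : ℕ) : ℝ) /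
      ((e + (if 1 ≤ i then (A.card - 1).choose (i - 1) * B.card.choose l else 0) +
        (if 1 ≤ l then A.card.choose i * (B.card - 1).choose (l - 1) else 0) : ℕ) : ℝ) * κ ≤
      y + ∑ z ∈ A, x z + ∑ z ∈ B, x z := by
  have hA : 0 ≤ ∑ z ∈ A, x z := Finset.sum_nonneg fun z _ => hx z
  have hB : 0 ≤ ∑ z ∈ B, x z := Finset.sum_nonneg fun z _ => hx z
  -- Double counting over all pairs `(s, t)`: each element of `A` and each element of `B` occurs
  -- equally often among its own kind.
  have h1 := Finset.sum_le_sum fun s hs => Finset.sum_le_sum fun t ht => h s hs t ht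
  simp only [Finset.sum_add_distrib, Finset.sum_const, Finset.card_powersetCard, nsmul_eq_mul,
    ← Finset.mul_sum, sum_powersetCard_sum] at h1
  generalize hc1 : (if 1 ≤ i then (A.card - 1).choose (i - 1) else 0) = c1 at h1
  generalize hc2 : (if 1 ≤ l then (B.card - 1).choose (l - 1) else 0) = c2 at h1
  have e1 : (if 1 ≤ i then (A.card - 1).choose (i - 1) * B.card.choose l else 0) =
      c1 * B.card.choose l := by rw [← hc1, ite_mul, zero_mul]
  have e2 : (if 1 ≤ l then A.card.choose i * (B.card - 1).choose (l - 1) else 0) =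
      A.card.choose i * c2 := by rw [← hc2, mul_ite, mul_zero]
  rw [e1, e2]
  push_cast at he ⊢
  rw [div_mul_eq_mul_div]
  -- A zero denominator is harmless, as the quotient is then 0. The terms `p1`, `p2`, `p3` pay for
  -- replacing the separate multiplicities of `y`, `X`, `Y` by the whole denominator.
  refine div_le_of_le_mul₀ (by positivity) (by positivity) ?_
  set a : ℝ := (A.card.choose i : ℝ)
  set b : ℝ := (B.card.choose l : ℝ)
  set X := ∑ z ∈ A, x z
  set Y := ∑ z ∈ B, x z
  have p1 : 0 ≤ (e : ℝ) * (X + Y) := by positivity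
  have p2 : 0 ≤ (c1 : ℝ) * b * (y + Y) := by positivity
  have p3 : 0 ≤ a * (c2 : ℝ) * (y + X) := by positivity
  linarith

end Averaging

lemma sup_mul_le {ι : Type*} {s : Finset ι} {f : ι → ℝ≥0} {κ X : ℝ} (hX : 0 ≤ X)
    (h : ∀ a ∈ s, (f a : ℝ) * κ ≤ X) : ((s.sup f : ℝ≥0) : ℝ) * κ ≤ X := by
  refine Finset.sup_induction (p := fun a : ℝ≥0 => (a : ℝ) * κ ≤ X) (by simpa using hX)
    (fun a ha b hb => ?_) h
  rcases max_choice a b with h | h <;> simpa [h]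

/-! ### The factors of the bound and the three alternatives -/

namespace Instance

variable {n : ℕ} (P : Instance n)

lemma point_nonneg (i j : Fin n) : 0 ≤ P.point i j := by
  rw [point]
  split_ifs <;> norm_num

lemma point_add_le_one (i j : Fin n) : P.point i j + P.point j i ≤ 1 := by
  by_cases h1 : i ∈ P.L j
  · rw [P.point_of_mem_L h1, P.point_of_mem_L' h1, add_zero]
  · by_cases h2 : j ∈ P.L i
    · rw [P.point_of_mem_L h2, P.point_of_mem_L' h2, zero_add]
    · rw [point, point, if_neg h1, if_neg h2]
      split_ifs <;> norm_num

variable {P}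

lemma mem_Psi {j : Fin n} {x : ℕ × ℕ} : x ∈ P.Psi j ↔
    (x.1 ≤ (P.I j).card ∧ x.2 ≤ (P.L j).card) ∧ 2 * P.d j + 1 ≤ (x.1 : ℝ) + 2 * x.2 := by
  simp [Psi]

lemma mem_Psi' {j : Fin n} {x : ℕ × ℕ} : x ∈ P.Psi' j ↔
    (x.1 < (P.I j).card ∧ x.2 ≤ (P.L j).card) ∧ 2 * P.d j - 1 ≤ (x.1 : ℝ) + 2 * x.2 := by
  simp [Psi']

lemma mem_Psi'' {j : Fin n} {x : ℕ × ℕ} : x ∈ P.Psi'' j ↔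
    (x.1 ≤ (P.I j).card ∧ x.2 < (P.L j).card) ∧ 2 * P.d j - 3 ≤ (x.1 : ℝ) + 2 * x.2 := by
  simp [Psi'']

lemma sum_one_sub_point_I {j : Fin n} {s : Finset (Fin n)} (hs : s ⊆ P.I j) :
    ∑ z ∈ s, (1 - P.point j z) = 1 / 2 * s.card := by
  rw [Finset.sum_congr rfl fun z hz => by
    rw [P.point_of_mem_I (P.mem_I_comm.1 (hs hz))], Finset.sum_const, nsmul_eq_mul]
  ring

lemma sum_one_sub_point_L {j : Fin n} {s : Finset (Fin n)} (hs : s ⊆ P.L j) :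
    ∑ z ∈ s, (1 - P.point j z) = s.card := by
  rw [Finset.sum_congr rfl fun z hz => by
    rw [P.point_of_mem_L' (hs hz)], Finset.sum_const, nsmul_eq_mul]
  ring

/-- A lower bound `κ` for the sum over all sets of duels whose change makes `j` better than `i`
implies the one with the factor of `j` for the sum over all superior or indifferent arms. -/
lemma factor_mul_le {i j : Fin n} {x : Fin n → ℝ} (hx : ∀ z, 0 ≤ x z) {κ : ℝ}
    (h : ∀ S ⊆ P.L j ∪ P.I j,
      P.d j < ∑ z ∈ S, (1 - P.point j z) + (if i ∈ S then P.point i j else 0) →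
        κ ≤ ∑ z ∈ S, x z) :
    (P.factor i j : ℝ) * κ ≤ ∑ z ∈ P.L j ∪ P.I j, x z := by
  have hX : 0 ≤ ∑ z ∈ P.L j ∪ P.I j, x z := Finset.sum_nonneg fun z _ => hx z
  have hLI := P.disjoint_L_I j
  have key : ∀ a b : ℝ≥0, (a : ℝ) * κ ≤ ∑ z ∈ P.L j ∪ P.I j, x z →
      (b : ℝ) * κ ≤ ∑ z ∈ P.L j ∪ P.I j, x z →
      ((max a b : ℝ≥0) : ℝ) * κ ≤ ∑ z ∈ P.L j ∪ P.I j, x z := fun a b ha hb => by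
    rcases max_choice a b with h | h <;> simpa only [h]
  refine key _ _ ?_ (key _ _ ?_ ?_)
  · refine sup_mul_le hX ?_
    rintro ⟨k, l⟩ hkl
    have hkl' := (mem_Psi.1 hkl).2
    dsimp only at hkl' ⊢
    -- The gain of `j` is `k / 2 + l`, which exceeds `d j` by the `+ 1` in `Ψ`.
    have := choose_div_mul_le (A := P.I j) (B := P.L j) (i := k) (l := l) (e := 0) (y := 0) (κ := κ)
      hx le_rfl (by simp) (fun s hs t ht => ?_)
    · rw [zero_add, zero_add] at this
      rwa [NNReal.coe_div, NNReal.coe_natCast, NNReal.coe_natCast, Finset.sum_union hLI,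
        add_comm (∑ z ∈ P.L j, x z)]
    · rw [Finset.mem_powersetCard] at hs ht
      have hd : Disjoint t s := hLI.mono ht.1 hs.1
      have h1 := h (t ∪ s) (Finset.union_subset_union ht.1 hs.1) (by
        rw [Finset.sum_union hd, sum_one_sub_point_I hs.1, sum_one_sub_point_L ht.1, hs.2, ht.2]
        have : 0 ≤ if i ∈ t ∪ s then P.point i j else 0 := by
          split_ifs
          exacts [P.point_nonneg _ _, le_rfl]
        linarith)
      rw [Finset.sum_union hd] at h1
      linarith
  · split_ifs with hi
    swap
    · simpa using hX
    refine sup_mul_le hX ?_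
    rintro ⟨k, l⟩ hkl
    have hkl' := (mem_Psi'.1 hkl).2
    dsimp only at hkl' ⊢
    -- Here `i` lies in every set, hence the extra summand `e`. Its duel shifts the difference of
    -- scores by `1/2 + 1/2 = 1`, so the threshold for `k + 2l` falls from `2d + 1` to `2d - 1`.
    have := choose_div_mul_le (A := (P.I j).erase i) (B := P.L j) (i := k) (l := l)
      (e := ((P.I j).erase i).card.choose k * (P.L j).card.choose l) (κ := κ)
      hx (hx i) le_rfl (fun s hs t ht => ?_)
    · rw [Finset.add_sum_erase _ _ hi, Finset.card_erase_of_mem hi, Nat.sub_sub] at this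
      rwa [NNReal.coe_div, NNReal.coe_natCast, NNReal.coe_natCast, Finset.sum_union hLI,
        add_comm (∑ z ∈ P.L j, x z)]
    · rw [Finset.mem_powersetCard, Finset.subset_erase] at hs
      rw [Finset.mem_powersetCard] at ht
      have hd : Disjoint t s := hLI.mono ht.1 hs.1.1
      have hit : i ∉ t ∪ s := by
        rw [Finset.mem_union, not_or]
        exact ⟨fun h' => P.notMem_I_of_mem_L (ht.1 h') hi, hs.1.2⟩
      have h1 := h (insert i (t ∪ s)) (Finset.insert_subset (Finset.mem_union_right _ hi)
        (Finset.union_subset_union ht.1 hs.1.1)) (by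
        rw [Finset.sum_insert hit, Finset.sum_union hd, sum_one_sub_point_I hs.1.1,
          sum_one_sub_point_L ht.1, hs.2, ht.2, if_pos (Finset.mem_insert_self _ _),
          P.point_of_mem_I hi, P.point_of_mem_I (P.mem_I_comm.1 hi)]
        linarith)
      rw [Finset.sum_insert hit, Finset.sum_union hd] at h1
      linarith
  · split_ifs with hi
    swap
    · simpa using hX
    refine sup_mul_le hX ?_
    rintro ⟨k, l⟩ hkl
    have hkl' := (mem_Psi''.1 hkl).2
    dsimp only at hkl' ⊢
    -- Now the duel with `i` turns from lost to won and shifts the difference by 2, so the threshold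
    -- falls to `2d - 3`.
    have := choose_div_mul_le (A := P.I j) (B := (P.L j).erase i) (i := k) (l := l)
      (e := (P.I j).card.choose k * ((P.L j).erase i).card.choose l) (κ := κ)
      hx (hx i) le_rfl (fun s hs t ht => ?_)
    · rw [add_right_comm (x i), Finset.add_sum_erase _ _ hi, Finset.card_erase_of_mem hi,
        Nat.sub_sub] at this
      rwa [NNReal.coe_div, NNReal.coe_natCast, NNReal.coe_natCast, Finset.sum_union hLI]
    · rw [Finset.mem_powersetCard] at hs
      rw [Finset.mem_powersetCard, Finset.subset_erase] at ht
      have hd : Disjoint t s := hLI.mono ht.1.1 hs.1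
      have hit : i ∉ t ∪ s := by
        rw [Finset.mem_union, not_or]
        exact ⟨ht.1.2, fun h' => P.notMem_I_of_mem_L hi (hs.1 h')⟩
      have h1 := h (insert i (t ∪ s)) (Finset.insert_subset (Finset.mem_union_left _ hi)
        (Finset.union_subset_union ht.1.1 hs.1)) (by
        rw [Finset.sum_insert hit, Finset.sum_union hd, sum_one_sub_point_I hs.1,
          sum_one_sub_point_L ht.1.1, hs.2, ht.2, if_pos (Finset.mem_insert_self _ _),
          P.point_of_mem_L hi, P.point_of_mem_L' hi]
        linarith)
      rw [Finset.sum_insert hit, Finset.sum_union hd] at h1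
      linarith

/-- The alternatives for an arm `j` that is not a Copeland winner. -/
lemma HasUniqueModes.alternatives (h : P.HasUniqueModes) {i j : Fin n} (hi : P.copelandSet = {i})
    (hj : j ≠ i) :
    (i ∉ P.L j ∪ P.I j ∧ ((P.I j).card, (P.L j).card) ∈ P.Psi j) ∨
      (i ∈ P.I j ∧ ((P.I j).card - 1, (P.L j).card) ∈ P.Psi' j) ∨
      (i ∈ P.L j ∧ ((P.I j).card, (P.L j).card - 1) ∈ P.Psi'' j) := by
  -- Twice this inequality shows that the largest pair of indices meets the threshold in each case.
  have hd := h.d_le hi hj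
  by_cases hL : i ∈ P.L j
  · have h1 := Finset.card_pos.2 ⟨i, hL⟩
    rw [P.point_of_mem_L hL] at hd
    refine .inr (.inr ⟨hL, mem_Psi''.2 ⟨⟨le_rfl, by dsimp only; omega⟩, ?_⟩⟩)
    push_cast [Nat.cast_sub (show 1 ≤ (P.L j).card from h1)]
    linarith
  · by_cases hI : i ∈ P.I j
    · have h1 := Finset.card_pos.2 ⟨i, hI⟩
      rw [P.point_of_mem_I hI] at hd
      refine .inr (.inl ⟨hI, mem_Psi'.2 ⟨⟨by dsimp only; omega, le_rfl⟩, ?_⟩⟩)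
      push_cast [Nat.cast_sub (show 1 ≤ (P.I j).card from h1)]
      linarith
    · have hLI : i ∉ P.L j ∪ P.I j := by simp [hL, hI]
      rw [P.point_of_notMem hLI] at hd
      refine .inl ⟨hLI, mem_Psi.2 ⟨⟨le_rfl, le_rfl⟩, ?_⟩⟩
      dsimp only
      linarith

/-- At the largest pair of indices the numerator is 1, so only a zero denominator could spoil
positivity. In `C'` and `C''` the first summand excludes it; in `C` it would need both indices to be
0, contrary to `d j > 0`. -/
lemma HasUniqueModes.factor_pos (h : P.HasUniqueModes) {i j : Fin n} (hi : P.copelandSet = {i})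
    (hj : j ≠ i) : 0 < P.factor i j := by
  rcases h.alternatives hi hj with ⟨-, hm⟩ | ⟨hI, hm⟩ | ⟨hL, hm⟩
  · refine lt_of_lt_of_le ?_ (le_max_left _ _)
    refine lt_of_lt_of_le ?_ (Finset.le_sup hm)
    have h1 := (mem_Psi.1 hm).2
    have h2 := d_pos hi hj
    dsimp only at h1 ⊢
    rcases Nat.eq_zero_or_pos (P.I j).card with h3 | h3
    · have h4 : 0 < (P.L j).card := by
        by_contra h4
        rw [h3, Nat.eq_zero_of_not_pos h4] at h1
        norm_num at h1
        linarith
      have h5 : 1 ≤ (P.L j).card := h4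
      simp [h3, h5]
    · have h5 : 1 ≤ (P.I j).card := h3
      simp only [Nat.choose_self, h5, if_true]
      positivity
  · refine lt_of_lt_of_le ?_ ((le_max_left _ _).trans (le_max_right _ _))
    rw [if_pos hI]
    refine lt_of_lt_of_le ?_ (Finset.le_sup hm)
    simp only [Nat.choose_self]
    positivity
  · refine lt_of_lt_of_le ?_ ((le_max_right _ _).trans (le_max_right _ _))
    rw [if_pos hL]
    refine lt_of_lt_of_le ?_ (Finset.le_sup hm)
    simp only [Nat.choose_self]
    positivity

/-- Without superior or indifferent arms the infimum in `lowerBound` is `∞`; a zero factor removes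
that summand. -/
lemma factor_eq_zero {i j : Fin n} (hi : P.copelandSet = {i}) (hj : j ≠ i)
    (h : P.L j ∪ P.I j = ∅) : P.factor i j = 0 := by
  have h1 := d_pos hi hj
  obtain ⟨hL, hI⟩ := Finset.union_eq_empty.1 h
  have hP : P.Psi j = ∅ := by
    refine Finset.eq_empty_of_forall_notMem fun x hx => ?_
    have h2 := mem_Psi.1 hx
    rw [hL, hI, Finset.card_empty, Nat.le_zero, Nat.le_zero] at h2
    rw [h2.1.1, h2.1.2] at h2
    norm_num at h2
    linarith
  simp [factor, C, hP, hL, hI]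

lemma IsPositive.inf_one_div_D_pos (h : P.IsPositive) (j : Fin n) :
    0 < (P.L j ∪ P.I j).inf fun z => 1 / P.D j z := by
  rw [Finset.lt_inf_iff ENNReal.zero_lt_top]
  intro z hz
  refine ENNReal.div_pos one_ne_zero (h.D_ne_top ?_)
  rintro rfl
  simp [mem_L, mem_I] at hz

lemma IsPositive.lowerBound_pos (h : P.IsPositive) (hu : P.HasUniqueModes) (hn : 2 ≤ n) {i : Fin n}
    (hi : P.copelandSet = {i}) {δ : ℝ} (h0 : 0 < δ) (h1 : 2.4 * δ < 1) :
    0 < P.lowerBound i δ := by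
  have : Nontrivial (Fin n) := Fin.nontrivial_iff_two_le.2 hn
  obtain ⟨j, hj⟩ := exists_ne i
  refine ENNReal.mul_pos ?_ ?_
  · rw [← pos_iff_ne_zero, ENNReal.ofReal_pos]
    exact Real.log_pos ((one_lt_div (by positivity)).2 h1)
  · intro h2
    have h3 := (Finset.sum_eq_zero_iff.1 h2) j (Finset.mem_erase.2 ⟨hj, Finset.mem_univ j⟩)
    rcases mul_eq_zero.1 h3 with h3 | h3
    · exact (hu.factor_pos hi hj).ne' (by exact_mod_cast h3)
    · exact (h.inf_one_div_D_pos j).ne' h3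

end Instance

/-! ### Summation over the arms -/

namespace Learner

variable {n : ℕ} {A : Learner n} {P : Instance n}

/-- A duel `(x, y)` is charged to `x` with the points of `y` and to `y` with the points of `x`,
together at most once. -/
lemma sum_point_mul_pairVisits_le (t : ℕ) :
    ∑ j, ∑ z ∈ P.L j ∪ P.I j, P.point z j * A.pairVisits P t j z ≤ ∑ x, A.visits P t x := by
  have h1 : ∀ j, ∑ z ∈ P.L j ∪ P.I j, P.point z j * A.pairVisits P t j z =
      ∑ z, P.point z j * A.visits P t (j, z) + ∑ z, P.point z j * A.visits P t (z, j) := by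
    intro j
    rw [← Finset.sum_add_distrib, Finset.sum_subset (Finset.subset_univ _) fun z _ hz => by
      rw [P.point_of_notMem hz, zero_mul]]
    exact Finset.sum_congr rfl fun z _ => by rw [pairVisits, mul_add]
  rw [Finset.sum_congr rfl fun j _ => h1 j, Finset.sum_add_distrib,
    Finset.sum_comm (f := fun j z => P.point z j * A.visits P t (z, j)), ← Finset.sum_add_distrib,
    Fintype.sum_prod_type]
  refine Finset.sum_le_sum fun j _ => ?_
  rw [← Finset.sum_add_distrib]
  refine Finset.sum_le_sum fun z _ => ?_
  rw [← add_mul]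
  exact mul_le_of_le_one_left (A.visits_nonneg P t _) (P.point_add_le_one _ _)

lemma lowerBound_le_expectedSamples {𝓜 : Set (Instance n)}
    (h𝓜 : 𝓜 = Set.univ ∨ 𝓜 = {P | P.HasUniqueModes}) {δ : ℝ} (h0 : 0 < δ)
    (hA : ∀ P ∈ 𝓜, A.IsCorrectAt P δ) (hP : P ∈ 𝓜) (hpos : P.IsPositive) {i : Fin n}
    (hi : P.copelandSet = {i}) : P.lowerBound i δ ≤ A.expectedSamples P := by
  -- In this case the truncated logarithm is 0; otherwise `δ < 1/2`, as the transportation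
  -- inequality needs.
  by_cases hδ : 1 ≤ 2.4 * δ
  · have : Real.log (1 / (2.4 * δ)) ≤ 0 :=
      Real.log_nonpos (by positivity) ((div_le_one (by positivity)).2 hδ)
    rw [Instance.lowerBound, ENNReal.ofReal_of_nonpos this, zero_mul]
    exact zero_le
  by_cases hR : A.expectedSamples P = ⊤
  · rw [hR]
    exact le_top
  have h1 : δ ≤ 1 / 2 := by norm_num at hδ; linarith
  set R := (A.expectedSamples P).toReal
  set m : Fin n → ℝ≥0∞ := fun j => (P.L j ∪ P.I j).inf fun z => 1 / P.D j z
  have hmD : ∀ j, ∀ z ∈ P.L j ∪ P.I j, m j ≠ ⊤ ∧ (m j).toReal * (P.D j z).toReal ≤ 1 := by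
    intro j z hz
    have hD := hpos.toReal_D_pos hz
    have h2 : m j ≤ 1 / P.D j z := Finset.inf_le hz
    have h3 : 1 / P.D j z ≠ ⊤ :=
      ENNReal.div_ne_top ENNReal.one_ne_top (ENNReal.toReal_pos_iff.1 hD).1.ne'
    refine ⟨ne_top_of_le_ne_top h3 h2, ?_⟩
    have h4 := ENNReal.toReal_mono h3 h2
    rwa [ENNReal.toReal_div, ENNReal.toReal_one, le_div_iff₀ hD] at h4
  set T : ℝ := ∑ j ∈ Finset.univ.erase i, (P.factor i j : ℝ) * (m j).toReal with hT
  have hT0 : 0 ≤ T := Finset.sum_nonneg fun j _ =>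
    mul_nonneg NNReal.zero_le_coe ENNReal.toReal_nonneg
  have hbound : ∀ t : ℕ, 0 < t →
      (1 - 2 * δ - 2 * (R / t)) * Real.log ((1 - δ) / δ) * T ≤ R := by
    intro t ht
    refine le_trans ?_ (A.expect_length_le P hR t)
    rw [← sum_visits]
    refine le_trans ?_ (sum_point_mul_pairVisits_le t)
    rw [hT, Finset.mul_sum]
    refine le_trans (Finset.sum_le_sum fun j hj => ?_)
      (Finset.sum_le_sum_of_subset_of_nonneg (Finset.erase_subset i _) fun j _ _ =>
        Finset.sum_nonneg fun z _ => mul_nonneg (P.point_nonneg _ _) (pairVisits_nonneg t _ _))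
    rw [mul_comm, mul_assoc]
    refine Instance.factor_mul_le
      (fun z => mul_nonneg (P.point_nonneg _ _) (pairVisits_nonneg t _ _)) fun S hS hd => ?_
    -- Multiplying by `m j` cancels the divergences, because `m j` times each of them is at most 1.
    refine (mul_le_mul_of_nonneg_left (le_sum_point_mul_pairVisits h𝓜 h0 h1 hA hP hpos hi hR ht
      (Finset.ne_of_mem_erase hj) hS hd) ENNReal.toReal_nonneg).trans ?_
    rw [Finset.mul_sum]
    refine Finset.sum_le_sum fun z hz => ?_
    have h2 := mul_le_mul_of_nonneg_right (hmD j z (hS hz)).2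
      (mul_nonneg (P.point_nonneg z j) (pairVisits_nonneg (A := A) (P := P) t j z))
    linarith
  have hlim : (1 - 2 * δ) * Real.log ((1 - δ) / δ) * T ≤ R := by
    have h2 := tendsto_const_div_atTop_nhds_zero_nat R
    have h3 := (((h2.const_mul 2).const_sub (1 - 2 * δ)).mul_const
      (Real.log ((1 - δ) / δ))).mul_const T
    rw [mul_zero, sub_zero] at h3
    exact le_of_tendsto h3 ((Filter.eventually_gt_atTop 0).mono hbound)
  -- `m j` is infinite only over an empty index set, where the factor vanishes.
  have hsum : ∑ j ∈ Finset.univ.erase i, (P.factor i j : ℝ≥0∞) * m j = ENNReal.ofReal T := by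
    rw [hT, ENNReal.ofReal_sum_of_nonneg fun j _ =>
      mul_nonneg NNReal.zero_le_coe ENNReal.toReal_nonneg]
    refine Finset.sum_congr rfl fun j hj => ?_
    rcases (P.L j ∪ P.I j).eq_empty_or_nonempty with h | ⟨z, hz⟩
    · simp [Instance.factor_eq_zero hi (Finset.ne_of_mem_erase hj) h]
    · rw [ENNReal.ofReal_mul NNReal.zero_le_coe, ENNReal.ofReal_toReal (hmD j z hz).1,
        ENNReal.ofReal_coe_nnreal]
  rw [Instance.lowerBound, hsum, ← ENNReal.ofReal_mul' hT0]
  refine ENNReal.ofReal_le_of_le_toReal (le_trans ?_ hlim)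
  exact mul_le_mul_of_nonneg_right (log_one_div_le_binaryKL h0 (by linarith)) hT0

end Learner
end DuelingBandits

end

open DuelingBandits
theorem mainTheorem2 (n : ℕ) (hn : 2 ≤ n) :
    -- the lower bound, for the class of all instances and for those with unique modes
    (∀ 𝓜 : Set (Instance n), (𝓜 = Set.univ ∨ 𝓜 = {P | P.HasUniqueModes}) →
      ∀ δ : ℝ, 0 < δ → δ < 1 →
      ∀ A : Learner n, (∀ P ∈ 𝓜, A.IsCorrectAt P δ) →
      ∀ P ∈ 𝓜, P.IsPositive → ∀ iStar : Fin n, P.copelandSet = {iStar} →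
        P.lowerBound iStar δ ≤ A.expectedSamples P) ∧
    -- for every arm exactly one of three alternatives holds
    (∀ P : Instance n, P.HasUniqueModes → ∀ iStar : Fin n, P.copelandSet = {iStar} →
      ∀ j, j ≠ iStar →
        ((iStar ∉ P.L j ∪ P.I j ∧ (P.Psi j).Nonempty) ∨
          (iStar ∈ P.I j ∧ (P.Psi' j).Nonempty) ∨
          (iStar ∈ P.L j ∧ (P.Psi'' j).Nonempty)) ∧
        ¬ ((iStar ∉ P.L j ∪ P.I j ∧ (P.Psi j).Nonempty) ∧
          (iStar ∈ P.I j ∧ (P.Psi' j).Nonempty)) ∧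
        ¬ ((iStar ∉ P.L j ∪ P.I j ∧ (P.Psi j).Nonempty) ∧
          (iStar ∈ P.L j ∧ (P.Psi'' j).Nonempty)) ∧
        ¬ ((iStar ∈ P.I j ∧ (P.Psi' j).Nonempty) ∧
          (iStar ∈ P.L j ∧ (P.Psi'' j).Nonempty)) ∧
        0 < P.factor iStar j) ∧
    -- the lower bound is positive
    (∀ P : Instance n, P.HasUniqueModes → P.IsPositive →
      ∀ iStar : Fin n, P.copelandSet = {iStar} →
      ∀ δ : ℝ, 0 < δ → 2.4 * δ < 1 → 0 < P.lowerBound iStar δ) := by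
  refine ⟨fun 𝓜 h𝓜 δ h0 _ A hA P hP hpos i hi =>
    Learner.lowerBound_le_expectedSamples h𝓜 h0 hA hP hpos hi,
    fun P hu i hi j hj => ⟨?_, ?_, ?_, ?_, hu.factor_pos hi hj⟩,
    fun P hu hpos i hi δ h0 h1 => hpos.lowerBound_pos hu hn hi h0 h1⟩
  · exact (hu.alternatives hi hj).imp (And.imp_right fun h => ⟨_, h⟩)
      (Or.imp (And.imp_right fun h => ⟨_, h⟩) (And.imp_right fun h => ⟨_, h⟩))
  · exact fun h => h.1.1 (Finset.mem_union_right _ h.2.1)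
  · exact fun h => h.1.1 (Finset.mem_union_left _ h.2.1)
  · exact fun h => P.notMem_I_of_mem_L h.2.1 h.1.1
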